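/- Let $x_1,\dots,x_K\in\mathbb R^d$ be pairwise distinct vectors spanning $\mathbb R^d$, let $\mu_0\in\mathbb R^d$, let $\Sigma_0\in\mathbb R^{d\times d}$ be a diagonal positive-definite matrix, and let $\sigma>0$. Write $\|v\|_S^2=v^\top S v$. In the linear Gaussian bandit, $\theta\sim\mathcal N(\mu_0,\Sigma_0)$ and, given $\theta$ and an arm schedule $A_1,A_2,\dots$ fixed in advance, the rewards are independent with $Y_t\sim\mathcal N(\theta^\top x_{A_t},\sigma^2)$. For a budget $n$, let $\omega$ be a Bayesian G-optimal design, i.e. a maximiser of $\omega\mapsto\log\det\big(\frac{n}{\sigma^2}\sum_k\omega_kx_kx_k^\top+\Sigma_0^{-1}\big)$ over the probability simplex (in particular, a maximiser over the weights that are all positive, if one exists). The algorithm plays each arm $i$ exactly $n_i=\lfloor\omega_i n\rfloor$ times, in any fixed order, and returns an arm $J_n\in\arg\max_i\mathbb E[\theta^\top x_i\mid H_n]$, where $H_n$ is the observed history and ties are broken in any measurable way. Let $i_*(\theta)\in\arg\max_i\theta^\top x_i$ and let $\mathcal P_n=\mathbb E[\mathbb P(J_n\ne i_*(\theta)\mid\theta)]$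 be the expected probability of error. Put $\hat\Sigma_n=\big(\Sigma_0^{-1}+\sigma^{-2}\sum_i n_ix_ix_i^\top\big)^{-1}$, $$C_n=\frac1{\sigma^4}\hat\Sigma_n\Big(\sum_i\big(n_i\sigma^2+n_i^2\,x_i^\top\Sigma_0x_i\big)x_ix_i^\top+\sum_{i\ne j}n_in_j\,(x_i^\top\Sigma_0x_j)\,x_ix_j^\top\Big)\hat\Sigma_n,\qquad c_{i,j}=\|x_i-x_j\|_{C_n}^2 .$$ Then $c_{i,j}$ is the variance of $\mathbb E[\theta^\top x_i\mid H_n]-\mathbb E[\theta^\top x_j\mid H_n]$. There are $c_0>0$ and $N\in\mathbb N$, depending only on $x_1,\dots,x_K,\mu_0,\Sigma_0,\sigma$, such that $c_{i,j}\ge c_0$ for all $i\ne j$, all $n\ge N$ and every such design $\omega$ (that is, $c_{i,j}=\Omega(1)$), and $$\mathcal P_n\le\sum_{i\ne j}\frac1{\sqrt{1+\frac{n}{2d\sigma^2}c_{i,j}}}\exp\Big(-\frac{(\mu_0^\top x_i-\mu_0^\top x_j)^2}{2\|x_i-x_j\|_{\Sigma_0}^2}\Big)$$ for every $n$ for which all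 $\omega_in$ are integers and, without this integrality condition, for every $n\ge N$. -/

import Mathlib

open MeasureTheory ProbabilityTheory

noncomputable section

namespace LinearBandit

variable {d K m : ℕ}

/-- Mean reward `θᵀ x_i` of arm `i` with feature vector `x i` under the parameter `θ`. -/
def meanReward (x : Fin K → EuclideanSpace ℝ (Fin d)) (θ : EuclideanSpace ℝ (Fin d))
    (i : Fin K) : ℝ :=
  (θ.ofLp ⬝ᵥ (x i).ofLp)

lemma measurable_meanReward (x : Fin K → EuclideanSpace ℝ (Fin d)) (i : Fin K) :
    Measurable fun θ => meanReward x θ i := by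
  unfold meanReward dotProduct
  fun_prop

/-- The squared norm `‖v‖²_S = vᵀ S v`. -/
def sqNorm (S : Matrix (Fin d) (Fin d) ℝ) (v : EuclideanSpace ℝ (Fin d)) : ℝ :=
  v.ofLp ⬝ᵥ S.mulVec v.ofLp

/-- The rank one matrix `x yᵀ`. -/
def outer (x y : EuclideanSpace ℝ (Fin d)) : Matrix (Fin d) (Fin d) ℝ :=
  Matrix.vecMulVec x.ofLp y.ofLp

/-! ### The Bayesian model -/

lemma pi_gaussianReal_eq_map (a : Fin m → ℝ) (v : NNReal) :
    Measure.pi (fun t => gaussianReal (a t) v) =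
      (Measure.pi (fun _ : Fin m => gaussianReal 0 v)).map (fun η t => η t + a t) := by
  have h := Measure.pi_map_pi (μ := fun _ : Fin m => gaussianReal 0 v)
    (f := fun t (y : ℝ) => y + a t) (fun t => by fun_prop)
  rw [h]
  simp [gaussianReal_map_add_const]

/-- Conditional law of the rewards `(Y_t)` given `θ`, when the arm played in round `t` is `A t`:
the `Y_t` are independent and `Y_t ∼ N(θᵀ x_{A t}, σ²)`. -/
def rewardKernel (x : Fin K → EuclideanSpace ℝ (Fin d)) (σ : ℝ) (A : Fin m → Fin K) :
    Kernel (EuclideanSpace ℝ (Fin d)) (Fin m → ℝ) where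
  toFun θ := Measure.pi fun t => gaussianReal (meanReward x θ (A t)) (σ ^ 2).toNNReal
  measurable' := by
    have hm := fun i => measurable_meanReward x i
    refine Measure.measurable_of_measurable_coe _ fun s hs => ?_
    have hf : Measurable fun p : EuclideanSpace ℝ (Fin d) × (Fin m → ℝ) =>
        fun t => p.2 t + meanReward x p.1 (A t) := by
      refine measurable_pi_lambda _ fun t => ?_
      exact ((measurable_pi_apply t).comp measurable_snd).add ((hm (A t)).comp measurable_fst)
    have key : ∀ θ : EuclideanSpace ℝ (Fin d),
        Measure.pi (fun t => gaussianReal (meanReward x θ (A t)) (σ ^ 2).toNNReal) s =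
          Measure.pi (fun _ : Fin m => gaussianReal 0 (σ ^ 2).toNNReal)
            (Prod.mk θ ⁻¹' ((fun p : EuclideanSpace ℝ (Fin d) × (Fin m → ℝ) =>
              fun t => p.2 t + meanReward x p.1 (A t)) ⁻¹' s)) := by
      intro θ
      rw [pi_gaussianReal_eq_map, Measure.map_apply (by fun_prop) hs]
      rfl
    simp_rw [key]
    exact measurable_measure_prodMk_left (hf hs)

instance (x : Fin K → EuclideanSpace ℝ (Fin d)) (σ : ℝ) (A : Fin m → Fin K) :
    IsMarkovKernel (rewardKernel x σ A) :=
  ⟨fun θ => by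
    change IsProbabilityMeasure (Measure.pi fun t =>
      gaussianReal (meanReward x θ (A t)) (σ ^ 2).toNNReal)
    infer_instance⟩

/-- Joint law of `(θ, Y)`, with prior `θ ∼ N(μ₀, Σ₀)`. As the arms `A` are chosen in advance, the
history is the reward vector `Y`. -/
def jointLaw (x : Fin K → EuclideanSpace ℝ (Fin d)) (μ₀ : EuclideanSpace ℝ (Fin d))
    (S₀ : Matrix (Fin d) (Fin d) ℝ) (σ : ℝ) (A : Fin m → Fin K) :
    Measure (EuclideanSpace ℝ (Fin d) × (Fin m → ℝ)) :=
  (multivariateGaussian μ₀ S₀).compProd (rewardKernel x σ A)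

/-- The mean posterior reward `E[r(i; θ) | H_n]` of arm `i`: the conditional expectation given the
`σ`-algebra of the history. -/
def postMeanReward (x : Fin K → EuclideanSpace ℝ (Fin d)) (μ₀ : EuclideanSpace ℝ (Fin d))
    (S₀ : Matrix (Fin d) (Fin d) ℝ) (σ : ℝ) (A : Fin m → Fin K) (i : Fin K) :
    EuclideanSpace ℝ (Fin d) × (Fin m → ℝ) → ℝ :=
  condExp (MeasurableSpace.comap Prod.snd inferInstance) (jointLaw x μ₀ S₀ σ A)
    (fun p => meanReward x p.1 i)

/-- `J` is a decision rule of PI-BAI: a measurable function of the history that almost surely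
selects an arm with the largest mean posterior reward. Ties may be broken in any way. -/
def IsPIBAIDecision (x : Fin K → EuclideanSpace ℝ (Fin d)) (μ₀ : EuclideanSpace ℝ (Fin d))
    (S₀ : Matrix (Fin d) (Fin d) ℝ) (σ : ℝ) (A : Fin m → Fin K) (J : (Fin m → ℝ) → Fin K) :
    Prop :=
  Measurable J ∧ ∀ᵐ p ∂(jointLaw x μ₀ S₀ σ A), ∀ k,
    postMeanReward x μ₀ S₀ σ A k p ≤ postMeanReward x μ₀ S₀ σ A (J p.2) p

/-- `iStar θ` is an optimal arm for every parameter `θ`. -/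
def IsOptimalArm (x : Fin K → EuclideanSpace ℝ (Fin d))
    (iStar : EuclideanSpace ℝ (Fin d) → Fin K) : Prop :=
  ∀ θ k, meanReward x θ k ≤ meanReward x θ (iStar θ)

/-- Expected probability of error `E[ P(J ≠ i⋆(θ) | θ) ]`, the outer expectation being taken over
the prior. -/
def expectedPoE (x : Fin K → EuclideanSpace ℝ (Fin d)) (μ₀ : EuclideanSpace ℝ (Fin d))
    (S₀ : Matrix (Fin d) (Fin d) ℝ) (σ : ℝ) (A : Fin m → Fin K) (J : (Fin m → ℝ) → Fin K)
    (iStar : EuclideanSpace ℝ (Fin d) → Fin K) : ℝ :=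
  ∫ θ, (rewardKernel x σ A θ).real {y | J y ≠ iStar θ} ∂(multivariateGaussian μ₀ S₀)

/-! ### Allocations -/

/-- The criterion `log det ((n / σ²) Σ_ω + Σ₀⁻¹)`, where `Σ_ω = ∑ k, ω_k x_k x_kᵀ`. -/
def designCriterion (x : Fin K → EuclideanSpace ℝ (Fin d)) (S₀ : Matrix (Fin d) (Fin d) ℝ)
    (σ : ℝ) (n : ℕ) (ω : Fin K → ℝ) : ℝ :=
  Real.log (Matrix.det (((n : ℝ) / σ ^ 2) • (∑ k, ω k • outer (x k) (x k)) + S₀⁻¹))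

/-- `ω` is a Bayesian G-optimal design: a point of the simplex at which the criterion is at least
as large as at every point of the simplex with positive weights. This covers the maximisers
over the positive weights and the maximisers over the whole simplex. -/
def IsGOptimal (x : Fin K → EuclideanSpace ℝ (Fin d)) (S₀ : Matrix (Fin d) (Fin d) ℝ)
    (σ : ℝ) (n : ℕ) (ω : Fin K → ℝ) : Prop :=
  ω ∈ stdSimplex ℝ (Fin K) ∧ ∀ ω' ∈ stdSimplex ℝ (Fin K), (∀ i, 0 < ω' i) →
    designCriterion x S₀ σ n ω' ≤ designCriterion x S₀ σ n ω

/-- Number `n_i = ⌊ω_i n⌋` of samples of arm `i`. -/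
def pulls (ω : Fin K → ℝ) (n : ℕ) (i : Fin K) : ℕ := ⌊ω i * n⌋₊

/-- `A` is a schedule in which every arm `i` is played exactly `⌊ω_i n⌋` times. -/
def IsSchedule (ω : Fin K → ℝ) (n : ℕ) (A : Fin m → Fin K) : Prop :=
  ∀ i, (Finset.univ.filter fun t => A t = i).card = pulls ω n i

/-! ### The constants -/

/-- Posterior covariance matrix `(Σ₀⁻¹ + σ⁻² ∑ i, n_i x_i x_iᵀ)⁻¹` of `θ`. -/
def postCov (x : Fin K → EuclideanSpace ℝ (Fin d)) (S₀ : Matrix (Fin d) (Fin d) ℝ)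
    (σ : ℝ) (N : Fin K → ℕ) : Matrix (Fin d) (Fin d) ℝ :=
  (S₀⁻¹ + (σ ^ 2)⁻¹ • ∑ i, (N i : ℝ) • outer (x i) (x i))⁻¹

/-- Covariance matrix of `∑ t, Y_t x_{A t}`, where arm `i` is played `n_i` times. -/
def rewardSumCov (x : Fin K → EuclideanSpace ℝ (Fin d)) (S₀ : Matrix (Fin d) (Fin d) ℝ)
    (σ : ℝ) (N : Fin K → ℕ) : Matrix (Fin d) (Fin d) ℝ :=
  (∑ i, ((N i : ℝ) * σ ^ 2 + (N i : ℝ) ^ 2 * ((x i).ofLp ⬝ᵥ S₀.mulVec (x i).ofLp)) •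
      outer (x i) (x i)) +
    ∑ i, ∑ j ∈ Finset.univ.erase i,
      ((N i : ℝ) * (N j : ℝ) * ((x i).ofLp ⬝ᵥ S₀.mulVec (x j).ofLp)) • outer (x i) (x j)

/-- Covariance matrix of the posterior mean of `θ`. -/
def postMeanCov (x : Fin K → EuclideanSpace ℝ (Fin d)) (S₀ : Matrix (Fin d) (Fin d) ℝ)
    (σ : ℝ) (N : Fin K → ℕ) : Matrix (Fin d) (Fin d) ℝ :=
  (σ ^ 4)⁻¹ • (postCov x S₀ σ N * rewardSumCov x S₀ σ N * postCov x S₀ σ N)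

/-- The constant `c_{i,j} = ‖x_i - x_j‖²` in the norm of the covariance of the posterior mean. -/
def gapConst (x : Fin K → EuclideanSpace ℝ (Fin d)) (S₀ : Matrix (Fin d) (Fin d) ℝ)
    (σ : ℝ) (N : Fin K → ℕ) (i j : Fin K) : ℝ :=
  sqNorm (postMeanCov x S₀ σ N) (x i - x j)

end LinearBandit

end

/-!
The posterior mean of `θᵀ v` is an affine function `Δ_v` of the rewards, and the error
`θᵀ v - Δ_v` is centred Gaussian with variance `s = vᵀ Σ̂ v`. Parameter and rewards are jointly
Gaussian (`jointLaw_eq_map`), so the error, being uncorrelated with the rewards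
(`covariance_residual_snd`), is independent of them (`indepFun_residual`). Hence `Δ_v` is the
conditional expectation of `θᵀ v` (`postMeanReward_ae_eq`), and its variance is `vᵀ Σ₀ v - s`, which
is `vᵀ C v` by the identity `C = Σ₀ - Σ̂` (`postMeanCov_eq`).

For a pair of arms put `v = x_i - x_j`, `δ = μ₀ᵀ v` and `c = c_{i,j}`. If `i` is returned then
`Δ_v ≥ 0`, and `θᵀ v ≤ 0` has conditional probability at most `exp (-Δ_v² / (2 s))`. The
events "`i` is returned" and "`j` is returned" are disjoint, so *both* ways of confusing `i` and `j`
together cost at most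
`E[exp (-Δ_v² / (2 s))] = (1 + c / s)^(-1/2) exp (-δ² / (2 (s + c)))`, where
`s + c = ‖x_i - x_j‖²_{Σ₀}` (`measureReal_confusion_add_le`, `integral_gapWeight`). The claimed
bound contains this pair twice, which leaves a factor of two to spare: it suffices that
`s ≤ 4 (2 d σ² / n)` (`one_div_sqrt_le`).

This bound on `s` comes from the design. The first order condition for the maximal determinant gives
`n x_kᵀ M⁻¹ x_k ≤ d σ²`, where `M` is the precision before rounding (`IsGOptimal.sqNorm_le`), so
`n vᵀ M⁻¹ v ≤ 4 d σ²`. If the `ω_i n` are integers, `M⁻¹ = Σ̂`. Otherwise rounding loses at most half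
of the precision as soon as `n ≥ 2 K d` (`IsGOptimal.sqNorm_postCov_le`), and
`n s ≤ 8 d σ²`. In particular `s → 0` uniformly over the designs, so that `c = vᵀ Σ₀ v - s` stays
bounded away from zero.
-/

namespace LinearBandit

open Matrix

variable {d K m : ℕ} {S₀ : Matrix (Fin d) (Fin d) ℝ}

/-! ### Information matrices and quadratic forms -/

lemma outer_mulVec (a b : EuclideanSpace ℝ (Fin d)) (v : Fin d → ℝ) :
    outer a b *ᵥ v = (b.ofLp ⬝ᵥ v) • a.ofLp := by
  ext i
  simp [outer, Matrix.vecMulVec_mulVec, mul_comm]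

lemma posSemidef_outer (a : EuclideanSpace ℝ (Fin d)) : (outer a a).PosSemidef := by
  simpa [outer] using Matrix.posSemidef_vecMulVec_self_star a.ofLp

/-- The information matrix `∑ i, w_i x_i x_iᵀ` of the arms with weights `w`. -/
def gram (x : Fin K → EuclideanSpace ℝ (Fin d)) (w : Fin K → ℝ) : Matrix (Fin d) (Fin d) ℝ :=
  ∑ i, w i • outer (x i) (x i)

lemma posSemidef_gram (x : Fin K → EuclideanSpace ℝ (Fin d)) {w : Fin K → ℝ} (hw : ∀ i, 0 ≤ w i) :
    (gram x w).PosSemidef :=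
  Matrix.posSemidef_sum _ fun i _ => (posSemidef_outer (x i)).smul (hw i)

lemma gram_mulVec (x : Fin K → EuclideanSpace ℝ (Fin d)) (w : Fin K → ℝ) (v : Fin d → ℝ) :
    gram x w *ᵥ v = ∑ i, (w i * ((x i).ofLp ⬝ᵥ v)) • (x i).ofLp := by
  simp [gram, Matrix.sum_mulVec, Matrix.smul_mulVec, outer_mulVec, smul_smul]

lemma outer_mul_mul_outer (S : Matrix (Fin d) (Fin d) ℝ) (a b : EuclideanSpace ℝ (Fin d)) :
    outer a a * S * outer b b = (a.ofLp ⬝ᵥ S *ᵥ b.ofLp) • outer a b := by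
  simp only [outer, Matrix.mul_vecMulVec, Matrix.vecMulVec_mul, Matrix.vecMulVec_mulVec,
    Matrix.smul_vecMulVec, Matrix.dotProduct_mulVec]
  ext i j
  simp [Matrix.vecMulVec_apply, mul_comm]

lemma rewardSumCov_eq (x : Fin K → EuclideanSpace ℝ (Fin d)) (S₀ : Matrix (Fin d) (Fin d) ℝ)
    (σ : ℝ) (N : Fin K → ℕ) :
    rewardSumCov x S₀ σ N = σ ^ 2 • gram x (fun i => (N i : ℝ)) +
      gram x (fun i => (N i : ℝ)) * S₀ * gram x (fun i => (N i : ℝ)) := by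
  have h : gram x (fun i => (N i : ℝ)) * S₀ * gram x (fun i => (N i : ℝ)) =
      ∑ i, ∑ j, ((N i : ℝ) * (N j : ℝ) * ((x i).ofLp ⬝ᵥ S₀ *ᵥ (x j).ofLp)) •
        outer (x i) (x j) := by
    simp only [gram, Finset.sum_mul, Finset.mul_sum, Matrix.smul_mul, Matrix.mul_smul,
      outer_mul_mul_outer, smul_smul]
    rw [Finset.sum_comm]
    refine Finset.sum_congr rfl fun i _ => Finset.sum_congr rfl fun j _ => ?_
    congr 1; ring
  rw [h, rewardSumCov, gram, Finset.smul_sum, ← Finset.sum_add_distrib, ← Finset.sum_add_distrib]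
  refine Finset.sum_congr rfl fun i _ => ?_
  rw [← Finset.add_sum_erase _ _ (Finset.mem_univ i), ← add_assoc, smul_smul, ← add_smul]
  congr 2; ring

lemma posDef_precision (hS : S₀.PosDef) (x : Fin K → EuclideanSpace ℝ (Fin d)) {w : Fin K → ℝ}
    (hw : ∀ i, 0 ≤ w i) {c : ℝ} (hc : 0 ≤ c) : (S₀⁻¹ + c • gram x w).PosDef :=
  hS.inv.add_posSemidef ((posSemidef_gram x hw).smul hc)

lemma postCov_eq (x : Fin K → EuclideanSpace ℝ (Fin d)) (σ : ℝ) (N : Fin K → ℕ) :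
    postCov x S₀ σ N = (S₀⁻¹ + (σ ^ 2)⁻¹ • gram x (fun i => (N i : ℝ)))⁻¹ := rfl

lemma posDef_postCov (hS : S₀.PosDef) (x : Fin K → EuclideanSpace ℝ (Fin d)) (σ : ℝ)
    (N : Fin K → ℕ) : (postCov x S₀ σ N).PosDef :=
  (posDef_precision hS x (fun i => by positivity) (by positivity)).inv

/-- The posterior covariance is the prior covariance minus the part explained by the rewards. -/
lemma postCov_mul_gram_mul (hS : S₀.PosDef) (x : Fin K → EuclideanSpace ℝ (Fin d)) (σ : ℝ)
    (N : Fin K → ℕ) :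
    postCov x S₀ σ N * ((σ ^ 2)⁻¹ • gram x (fun i => (N i : ℝ))) * S₀ =
      S₀ - postCov x S₀ σ N := by
  set g := (σ ^ 2)⁻¹ • gram x (fun i => (N i : ℝ)) with hg
  have hu : IsUnit (S₀⁻¹ + g).det :=
    (posDef_precision hS x (fun i => by positivity) (by positivity)).isUnit.map
      Matrix.detMonoidHom
  have hS' : IsUnit S₀.det := hS.isUnit.map Matrix.detMonoidHom
  have h1 : postCov x S₀ σ N * (S₀⁻¹ + g) = 1 := by
    rw [postCov_eq, ← hg, Matrix.nonsing_inv_mul _ hu]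
  calc postCov x S₀ σ N * g * S₀
      = postCov x S₀ σ N * (S₀⁻¹ + g) * S₀ - postCov x S₀ σ N * (S₀⁻¹ * S₀) := by
        noncomm_ring
    _ = S₀ - postCov x S₀ σ N := by rw [h1, Matrix.nonsing_inv_mul _ hS', one_mul, mul_one]

/-- Law of total covariance for the posterior mean of `θ`. -/
lemma postMeanCov_eq (hS : S₀.PosDef) (x : Fin K → EuclideanSpace ℝ (Fin d)) {σ : ℝ} (hσ : 0 < σ)
    (N : Fin K → ℕ) : postMeanCov x S₀ σ N = S₀ - postCov x S₀ σ N := by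
  set G := gram x (fun i => (N i : ℝ)) with hG
  set T := postCov x S₀ σ N with hT
  have hS' : IsUnit S₀.det := hS.isUnit.map Matrix.detMonoidHom
  have hu : IsUnit (S₀⁻¹ + (σ ^ 2)⁻¹ • G).det :=
    (posDef_precision hS x (fun i => by positivity) (by positivity)).isUnit.map
      Matrix.detMonoidHom
  have h1 : (S₀⁻¹ + (σ ^ 2)⁻¹ • G) * T = 1 := by
    rw [hT, postCov_eq, Matrix.mul_nonsing_inv _ hu]
  have h2 := postCov_mul_gram_mul hS x σ N
  rw [← hT, ← hG] at h2
  calc postMeanCov x S₀ σ N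
      = T * ((σ ^ 2)⁻¹ • G) * (S₀ * S₀⁻¹) * T + T * ((σ ^ 2)⁻¹ • G) * S₀ * ((σ ^ 2)⁻¹ • G) * T := by
        rw [postMeanCov, rewardSumCov_eq, ← hT, ← hG, Matrix.mul_nonsing_inv _ hS', mul_one]
        simp only [mul_add, add_mul, smul_add, Matrix.smul_mul, Matrix.mul_smul, smul_smul,
          mul_assoc]
        congr 2
        · field_simp
        · field_simp
    _ = T * ((σ ^ 2)⁻¹ • G) * S₀ * ((S₀⁻¹ + (σ ^ 2)⁻¹ • G) * T) := by noncomm_ring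
    _ = S₀ - T := by rw [h1, mul_one, h2]

lemma gapConst_eq (hS : S₀.PosDef) (x : Fin K → EuclideanSpace ℝ (Fin d)) {σ : ℝ} (hσ : 0 < σ)
    (N : Fin K → ℕ) (i j : Fin K) :
    gapConst x S₀ σ N i j = sqNorm S₀ (x i - x j) - sqNorm (postCov x S₀ σ N) (x i - x j) := by
  rw [gapConst, postMeanCov_eq hS x hσ]
  simp only [sqNorm, Matrix.sub_mulVec, dotProduct_sub]

lemma sqNorm_pos {S : Matrix (Fin d) (Fin d) ℝ} (hS : S.PosDef) {v : EuclideanSpace ℝ (Fin d)}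
    (hv : v ≠ 0) : 0 < sqNorm S v := by
  simpa [sqNorm] using hS.dotProduct_mulVec_pos (x := v.ofLp) (by simpa using hv)

lemma sqNorm_nonneg {S : Matrix (Fin d) (Fin d) ℝ} (hS : S.PosSemidef)
    (v : EuclideanSpace ℝ (Fin d)) : 0 ≤ sqNorm S v := by
  simpa [sqNorm] using hS.dotProduct_mulVec_nonneg v.ofLp

lemma dotProduct_mulVec_symm {S : Matrix (Fin d) (Fin d) ℝ} (hS : S.IsHermitian)
    (u v : Fin d → ℝ) : u ⬝ᵥ S *ᵥ v = v ⬝ᵥ S *ᵥ u := by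
  have h : Sᵀ = S := by
    simpa [Matrix.IsHermitian, Matrix.conjTranspose_eq_transpose_of_trivial] using hS
  rw [Matrix.dotProduct_mulVec, dotProduct_comm, ← Matrix.mulVec_transpose, h]

lemma sqNorm_sub_le {S : Matrix (Fin d) (Fin d) ℝ} (hS : S.PosSemidef)
    (u v : EuclideanSpace ℝ (Fin d)) : sqNorm S (u - v) ≤ 2 * (sqNorm S u + sqNorm S v) := by
  have h := sqNorm_nonneg hS (u + v)
  simp only [sqNorm, WithLp.ofLp_add, WithLp.ofLp_sub, Matrix.mulVec_add, Matrix.mulVec_sub,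
    dotProduct_add, dotProduct_sub, add_dotProduct, sub_dotProduct] at h ⊢
  linarith

/-- Cauchy–Schwarz inequality for the dual norms `‖·‖_M` and `‖·‖_{M⁻¹}`. -/
lemma dotProduct_sq_le {M : Matrix (Fin d) (Fin d) ℝ} (hM : M.PosDef) (a u : Fin d → ℝ) :
    (a ⬝ᵥ u) ^ 2 ≤ (a ⬝ᵥ M⁻¹ *ᵥ a) * (u ⬝ᵥ M *ᵥ u) := by
  have hu : IsUnit M.det := hM.isUnit.map Matrix.detMonoidHom
  have h : ∀ t : ℝ, 0 ≤ (a ⬝ᵥ M⁻¹ *ᵥ a) * (t * t) + (-(2 * (a ⬝ᵥ u))) * t + u ⬝ᵥ M *ᵥ u := by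
    intro t
    have h0 := hM.posSemidef.dotProduct_mulVec_nonneg (u - t • M⁻¹ *ᵥ a)
    have e1 : M *ᵥ (M⁻¹ *ᵥ a) = a := by
      rw [Matrix.mulVec_mulVec, Matrix.mul_nonsing_inv _ hu, Matrix.one_mulVec]
    have e2 : (M⁻¹ *ᵥ a) ⬝ᵥ M *ᵥ u = a ⬝ᵥ u := by
      rw [dotProduct_mulVec_symm hM.isHermitian, e1, dotProduct_comm]
    simp only [star_trivial, Matrix.mulVec_sub, Matrix.mulVec_smul, e1, dotProduct_sub,
      sub_dotProduct, dotProduct_smul, smul_dotProduct, e2, smul_eq_mul] at h0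
    rw [dotProduct_comm u a, dotProduct_comm (M⁻¹ *ᵥ a) a] at h0
    linarith
  have := discrim_le_zero h
  rw [discrim] at this
  nlinarith

/-- Inversion is antitone for the Loewner order, up to the factor `c`. -/
lemma inv_dotProduct_le {M M' : Matrix (Fin d) (Fin d) ℝ} (hM : M.PosDef) (hM' : M'.PosDef)
    {c : ℝ} (h : ∀ u, u ⬝ᵥ M *ᵥ u ≤ c * (u ⬝ᵥ M' *ᵥ u)) (v : Fin d → ℝ) :
    v ⬝ᵥ M'⁻¹ *ᵥ v ≤ c * (v ⬝ᵥ M⁻¹ *ᵥ v) := by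
  have hu : IsUnit M'.det := hM'.isUnit.map Matrix.detMonoidHom
  set u := M'⁻¹ *ᵥ v with hu'
  have e1 : M' *ᵥ u = v := by
    rw [hu', Matrix.mulVec_mulVec, Matrix.mul_nonsing_inv _ hu, Matrix.one_mulVec]
  have h1 := dotProduct_sq_le hM v u
  have h2 := h u
  rw [e1, dotProduct_comm u v] at h2
  rcases eq_or_ne v 0 with hv | hv
  · simp [hv]
  have h3 : 0 ≤ v ⬝ᵥ M⁻¹ *ᵥ v := by simpa using hM.inv.posSemidef.dotProduct_mulVec_nonneg v
  have h4 : 0 < v ⬝ᵥ u := by simpa using hM'.inv.dotProduct_mulVec_pos hv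
  nlinarith [mul_le_mul_of_nonneg_left h2 h3]

/-! ### Precision attained by Bayesian G-optimal designs -/

/-- If the determinant does not increase when moving from `M` in the direction `D`, then its
directional derivative `det M * tr (M⁻¹ D)` is nonpositive. -/
lemma trace_inv_mul_nonpos {M D : Matrix (Fin d) (Fin d) ℝ} (hM : 0 < M.det)
    (h : ∀ t : ℝ, 0 < t → t ≤ 1 → (M + t • D).det ≤ M.det) : (M⁻¹ * D).trace ≤ 0 := by
  have hu : IsUnit M.det := hM.ne'.isUnit
  by_contra! hpos
  set p := (det (1 + (Polynomial.X : Polynomial ℝ) • (M⁻¹ * D).map Polynomial.C)).divX.divX with hp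
  have hcont : Filter.Tendsto (fun t : ℝ => (M⁻¹ * D).trace + p.eval t * t)
      (nhdsWithin 0 (Set.Ioi 0)) (nhds ((M⁻¹ * D).trace + p.eval 0 * 0)) :=
    ((by fun_prop : Continuous fun t : ℝ => (M⁻¹ * D).trace + p.eval t * t).tendsto 0).mono_left
      nhdsWithin_le_nhds
  have h1 : ∀ᶠ t : ℝ in nhdsWithin 0 (Set.Ioi 0), 0 < (M⁻¹ * D).trace + p.eval t * t :=
    hcont.eventually_const_lt (by simpa using hpos)
  have h2 : ∀ᶠ t : ℝ in nhdsWithin 0 (Set.Ioi 0), t ≤ 1 :=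
    nhdsWithin_le_nhds (eventually_le_nhds one_pos)
  obtain ⟨t, ⟨ht1, ht2⟩, ht0 : 0 < t⟩ :=
    ((h1.and h2).and self_mem_nhdsWithin).exists
  have h3 := h t ht0 ht2
  have h4 : M + t • D = M * (1 + t • (M⁻¹ * D)) := by
    rw [mul_add, mul_one, Matrix.mul_smul, ← mul_assoc, Matrix.mul_nonsing_inv _ hu, one_mul]
  rw [h4, Matrix.det_mul, Matrix.det_one_add_smul, ← hp] at h3
  have h5 : 0 < ((M⁻¹ * D).trace + p.eval t * t) * t := mul_pos ht1 ht0
  nlinarith [mul_pos hM h5]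

lemma trace_mul_gram (x : Fin K → EuclideanSpace ℝ (Fin d)) (w : Fin K → ℝ)
    (T : Matrix (Fin d) (Fin d) ℝ) : (T * gram x w).trace = ∑ i, w i * sqNorm T (x i) := by
  simp only [gram, Finset.mul_sum, Matrix.trace_sum, Matrix.mul_smul, Matrix.trace_smul, outer,
    Matrix.mul_vecMulVec, Matrix.trace_vecMulVec, smul_eq_mul, sqNorm]
  exact Finset.sum_congr rfl fun i _ => by rw [dotProduct_comm]

open scoped MatrixOrder in
lemma trace_mul_nonneg_of_posSemidef {T P : Matrix (Fin d) (Fin d) ℝ} (hT : T.PosSemidef)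
    (hP : P.PosSemidef) : 0 ≤ (T * P).trace := by
  obtain ⟨B, hB, -, rfl⟩ := CFC.exists_sqrt_of_isSelfAdjoint_of_quasispectrumRestricts
    hP.isHermitian (QuasispectrumRestricts.nnreal_of_nonneg hP.nonneg)
  have hB' : Bᴴ = B := hB
  rw [← mul_assoc, Matrix.trace_mul_comm, ← mul_assoc]
  have h := (hT.mul_mul_conjTranspose_same B).trace_nonneg
  rwa [hB'] at h

/-- A bound for the means with positive weights holds at the vertices of the simplex. -/
lemma le_of_forall_simplex {a : Fin K → ℝ} {τ : ℝ}
    (h : ∀ w ∈ stdSimplex ℝ (Fin K), (∀ i, 0 < w i) → ∑ i, w i * a i ≤ τ) (k : Fin K) :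
    a k ≤ τ := by
  have hK : (0 : ℝ) < K := by exact_mod_cast k.pos
  set b := ∑ i, (1 / (K : ℝ)) * a i with hb
  have key : ∀ ε : ℝ, 0 < ε → ε < 1 → (1 - ε) * a k + ε * b ≤ τ := by
    intro ε h0 h1
    have h2 := h (fun i => (1 - ε) * (if i = k then 1 else 0) + ε * (1 / (K : ℝ))) ⟨fun i => by
        have : (0 : ℝ) ≤ if i = k then 1 else 0 := by split_ifs <;> simp
        have := mul_nonneg (sub_nonneg.2 h1.le) this
        positivity, by
        simp [Finset.sum_add_distrib]
        field_simp
        ring⟩ fun i => by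
        have : (0 : ℝ) ≤ if i = k then 1 else 0 := by split_ifs <;> simp
        have := mul_nonneg (sub_nonneg.2 h1.le) this
        positivity
    have h3 : ∑ i, ((1 - ε) * (if i = k then 1 else 0) + ε * (1 / (K : ℝ))) * a i =
        (1 - ε) * a k + ε * b := by
      simp only [add_mul, Finset.sum_add_distrib, hb, Finset.mul_sum, mul_assoc, ite_mul, one_mul,
        zero_mul, mul_ite, mul_zero, Finset.sum_ite_eq', Finset.mem_univ, if_true]
    linarith
  have hlim : Filter.Tendsto (fun ε : ℝ => (1 - ε) * a k + ε * b)
      (nhdsWithin 0 (Set.Ioi 0)) (nhds ((1 - 0) * a k + 0 * b)) :=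
    ((by fun_prop : Continuous fun ε : ℝ => (1 - ε) * a k + ε * b).tendsto 0).mono_left
      nhdsWithin_le_nhds
  have := le_of_tendsto hlim (b := τ) (by
    filter_upwards [self_mem_nhdsWithin, nhdsWithin_le_nhds (eventually_lt_nhds one_pos)]
      with ε h0 h1
    exact key ε h0 h1)
  simpa using this

/-- The unrounded posterior precision matrix `(n / σ²) ∑ k, ω_k x_k x_kᵀ + Σ₀⁻¹`. -/
noncomputable def designPrecision (x : Fin K → EuclideanSpace ℝ (Fin d))
    (S₀ : Matrix (Fin d) (Fin d) ℝ) (σ : ℝ) (n : ℕ) (ω : Fin K → ℝ) : Matrix (Fin d) (Fin d) ℝ :=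
  S₀⁻¹ + ((n : ℝ) / σ ^ 2) • gram x ω

lemma posDef_designPrecision (hS : S₀.PosDef) (x : Fin K → EuclideanSpace ℝ (Fin d)) (σ : ℝ)
    (n : ℕ) {ω : Fin K → ℝ} (hω : ω ∈ stdSimplex ℝ (Fin K)) :
    (designPrecision x S₀ σ n ω).PosDef :=
  posDef_precision hS x hω.1 (by positivity)

/-- Kiefer–Wolfowitz bound for a Bayesian G-optimal design. -/
lemma IsGOptimal.sqNorm_le {x : Fin K → EuclideanSpace ℝ (Fin d)} (hS : S₀.PosDef) {σ : ℝ}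
    (hσ : 0 < σ) {n : ℕ} {ω : Fin K → ℝ} (h : IsGOptimal x S₀ σ n ω) (k : Fin K) :
    n * sqNorm (designPrecision x S₀ σ n ω)⁻¹ (x k) ≤ d * σ ^ 2 := by
  set M := designPrecision x S₀ σ n ω with hM
  have hMpos : M.PosDef := posDef_designPrecision hS x σ n h.1
  have hu : IsUnit M.det := hMpos.isUnit.map Matrix.detMonoidHom
  set b : ℝ := n / σ ^ 2 with hb
  have hb0 : 0 ≤ b := by positivity
  have hcrit : ∀ w, designCriterion x S₀ σ n w = Real.log (designPrecision x S₀ σ n w).det := by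
    intro w
    rw [designCriterion, designPrecision, add_comm]; rfl
  have htot : b * ∑ i, ω i * sqNorm M⁻¹ (x i) ≤ d := by
    have h1 : (M⁻¹ * (S₀⁻¹ + b • gram x ω)).trace = d := by
      change (M⁻¹ * M).trace = d
      rw [Matrix.nonsing_inv_mul _ hu, Matrix.trace_one, Fintype.card_fin]
    rw [mul_add, Matrix.trace_add, Matrix.mul_smul, Matrix.trace_smul, trace_mul_gram,
      smul_eq_mul] at h1
    linarith [trace_mul_nonneg_of_posSemidef hMpos.inv.posSemidef hS.inv.posSemidef]
  have hdir : ∀ w ∈ stdSimplex ℝ (Fin K), (∀ i, 0 < w i) →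
      ∑ i, w i * (b * sqNorm M⁻¹ (x i)) ≤ d := by
    intro w hw hwpos
    have h1 : (M⁻¹ * (b • (gram x w - gram x ω))).trace ≤ 0 := by
      refine trace_inv_mul_nonpos hMpos.det_pos fun t ht0 ht1 => ?_
      have hmem : (fun i => (1 - t) * ω i + t * w i) ∈ stdSimplex ℝ (Fin K) :=
        (convex_stdSimplex ℝ (Fin K)) h.1 hw (sub_nonneg.2 ht1) ht0.le (by ring)
      have h2 := h.2 _ hmem fun i => by
        have := mul_nonneg (sub_nonneg.2 ht1) (h.1.1 i)
        have := mul_pos ht0 (hwpos i)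
        positivity
      have h3 : designPrecision x S₀ σ n (fun i => (1 - t) * ω i + t * w i) =
          M + t • (b • (gram x w - gram x ω)) := by
        have : gram x (fun i => (1 - t) * ω i + t * w i) =
            gram x ω + t • (gram x w - gram x ω) := by
          simp only [gram, Finset.smul_sum, ← Finset.sum_sub_distrib,
            ← Finset.sum_add_distrib]
          refine Finset.sum_congr rfl fun i _ => ?_
          module
        rw [hM, designPrecision, designPrecision, this, ← hb]
        module
      rw [hcrit, hcrit, ← hM, h3] at h2
      refine (Real.log_le_log_iff ?_ hMpos.det_pos).1 h2
      rw [← h3]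
      exact (posDef_designPrecision hS x σ n hmem).det_pos
    rw [Matrix.mul_smul, Matrix.trace_smul, mul_sub, Matrix.trace_sub, trace_mul_gram,
      trace_mul_gram, smul_eq_mul] at h1
    have : ∑ i, w i * (b * sqNorm M⁻¹ (x i)) = b * ∑ i, w i * sqNorm M⁻¹ (x i) := by
      rw [Finset.mul_sum]
      exact Finset.sum_congr rfl fun i _ => by ring
    linarith
  have h4 := le_of_forall_simplex hdir k
  have : (n : ℝ) * sqNorm M⁻¹ (x k) = b * sqNorm M⁻¹ (x k) * σ ^ 2 := by
    rw [hb]; field_simp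
  rw [this]
  exact mul_le_mul_of_nonneg_right h4 (by positivity)

/-- If all `ω i * n` are integers then rounding changes nothing. -/
lemma postCov_pulls_of_integral (x : Fin K → EuclideanSpace ℝ (Fin d)) (σ : ℝ) {n : ℕ}
    {ω : Fin K → ℝ} (h : ∀ i, (pulls ω n i : ℝ) = ω i * n) :
    postCov x S₀ σ (pulls ω n) = (designPrecision x S₀ σ n ω)⁻¹ := by
  have : (σ ^ 2)⁻¹ • gram x (fun i => (pulls ω n i : ℝ)) = ((n : ℝ) / σ ^ 2) • gram x ω := by
    simp only [gram, Finset.smul_sum, smul_smul, h]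
    refine Finset.sum_congr rfl fun i _ => ?_
    congr 1; ring
  rw [postCov_eq, designPrecision, this]

lemma dotProduct_gram_mulVec (x : Fin K → EuclideanSpace ℝ (Fin d)) (w : Fin K → ℝ)
    (u : Fin d → ℝ) : u ⬝ᵥ gram x w *ᵥ u = ∑ i, w i * ((x i).ofLp ⬝ᵥ u) ^ 2 := by
  rw [gram_mulVec, dotProduct_sum]
  refine Finset.sum_congr rfl fun i _ => ?_
  rw [dotProduct_smul, smul_eq_mul, dotProduct_comm u]
  ring

/-- For `n ≥ 2Kd`, rounding the allocation down at most halves the precision: by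
Cauchy–Schwarz and the Kiefer–Wolfowitz bound, `(x_iᵀ u)² ≤ (d σ² / n) ‖u‖²_M`, so the lost
information `σ⁻² ∑ i, x_i x_iᵀ` is at most `(K d / n) M`. -/
lemma IsGOptimal.sqNorm_postCov_le {x : Fin K → EuclideanSpace ℝ (Fin d)} (hS : S₀.PosDef)
    {σ : ℝ} (hσ : 0 < σ) {n : ℕ} {ω : Fin K → ℝ} (h : IsGOptimal x S₀ σ n ω)
    (hn : 2 * K * d ≤ n) (v : EuclideanSpace ℝ (Fin d)) :
    sqNorm (postCov x S₀ σ (pulls ω n)) v ≤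
      2 * sqNorm (designPrecision x S₀ σ n ω)⁻¹ v := by
  set M := designPrecision x S₀ σ n ω with hM
  have hMpos : M.PosDef := posDef_designPrecision hS x σ n h.1
  have hM' : (S₀⁻¹ + (σ ^ 2)⁻¹ • gram x (fun i => (pulls ω n i : ℝ))).PosDef :=
    posDef_precision hS x (fun i => by positivity) (by positivity)
  rw [sqNorm, postCov_eq]
  refine inv_dotProduct_le hMpos hM' (fun u => ?_) _
  have hq : 0 ≤ u ⬝ᵥ M *ᵥ u := by simpa using hMpos.posSemidef.dotProduct_mulVec_nonneg u
  set q := u ⬝ᵥ M *ᵥ u with hqdef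
  set p := u ⬝ᵥ S₀⁻¹ *ᵥ u with hp
  have hp0 : 0 ≤ p := by simpa using hS.inv.posSemidef.dotProduct_mulVec_nonneg u
  have hqe : q = p + (n : ℝ) / σ ^ 2 * ∑ i, ω i * ((x i).ofLp ⬝ᵥ u) ^ 2 := by
    rw [hqdef, hM, designPrecision, Matrix.add_mulVec, dotProduct_add, Matrix.smul_mulVec,
      dotProduct_smul, dotProduct_gram_mulVec, smul_eq_mul]
  rw [Matrix.add_mulVec, dotProduct_add, Matrix.smul_mulVec,
      dotProduct_smul, dotProduct_gram_mulVec, smul_eq_mul, ← hp]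
  have hσ2 : 0 < σ ^ 2 := by positivity
  have hround : ∑ i, ω i * n * ((x i).ofLp ⬝ᵥ u) ^ 2 - ∑ i, ((x i).ofLp ⬝ᵥ u) ^ 2 ≤
      ∑ i, (pulls ω n i : ℝ) * ((x i).ofLp ⬝ᵥ u) ^ 2 := by
    rw [← Finset.sum_sub_distrib]
    refine Finset.sum_le_sum fun i _ => ?_
    have h1 : ω i * n < pulls ω n i + 1 := Nat.lt_floor_add_one _
    nlinarith [sq_nonneg ((x i).ofLp ⬝ᵥ u)]
  have hlost : 2 * ((σ ^ 2)⁻¹ * ∑ i, ((x i).ofLp ⬝ᵥ u) ^ 2) ≤ q := by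
    rcases Nat.eq_zero_or_pos n with rfl | hn0
    · -- the budget is zero, so there are no arms or the vectors have no entries
      have : K = 0 ∨ d = 0 := by simpa using hn
      rcases this with rfl | rfl
      · simpa using hq
      · simpa using hq
    have hn0 : (0 : ℝ) < n := by exact_mod_cast hn0
    have h2 : n * ∑ i, ((x i).ofLp ⬝ᵥ u) ^ 2 ≤ K * (d * σ ^ 2 * q) := by
      rw [Finset.mul_sum]
      refine (Finset.sum_le_card_nsmul _ _ (d * σ ^ 2 * q) fun i _ => ?_).trans (by simp)
      have h3 := dotProduct_sq_le hMpos (x i).ofLp u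
      have h4 := h.sqNorm_le hS hσ i
      calc n * ((x i).ofLp ⬝ᵥ u) ^ 2 ≤ n * (sqNorm M⁻¹ (x i) * q) := by gcongr; exact h3
        _ = n * sqNorm M⁻¹ (x i) * q := by ring
        _ ≤ d * σ ^ 2 * q := by gcongr
    have h5 : (2 * K * d : ℝ) ≤ n := by exact_mod_cast hn
    have h6 : (n * σ ^ 2) * (2 * ((σ ^ 2)⁻¹ * ∑ i, ((x i).ofLp ⬝ᵥ u) ^ 2)) ≤ (n * σ ^ 2) * q := by
      calc (n * σ ^ 2) * (2 * ((σ ^ 2)⁻¹ * ∑ i, ((x i).ofLp ⬝ᵥ u) ^ 2))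
          = 2 * (n * ∑ i, ((x i).ofLp ⬝ᵥ u) ^ 2) := by field_simp
        _ ≤ 2 * (K * (d * σ ^ 2 * q)) := by gcongr
        _ = (2 * K * d) * (σ ^ 2 * q) := by ring
        _ ≤ n * (σ ^ 2 * q) := by gcongr
        _ = _ := by ring
    exact le_of_mul_le_mul_left h6 (by positivity)
  have h7 : (σ ^ 2)⁻¹ * (∑ i, ω i * n * ((x i).ofLp ⬝ᵥ u) ^ 2 - ∑ i, ((x i).ofLp ⬝ᵥ u) ^ 2) ≤
      (σ ^ 2)⁻¹ * ∑ i, (pulls ω n i : ℝ) * ((x i).ofLp ⬝ᵥ u) ^ 2 :=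
    mul_le_mul_of_nonneg_left hround (by positivity)
  have h8 : (n : ℝ) / σ ^ 2 * ∑ i, ω i * ((x i).ofLp ⬝ᵥ u) ^ 2 =
      (σ ^ 2)⁻¹ * ∑ i, ω i * n * ((x i).ofLp ⬝ᵥ u) ^ 2 := by
    rw [Finset.mul_sum, Finset.mul_sum]
    refine Finset.sum_congr rfl fun i _ => ?_
    ring
  rw [h8] at hqe
  linarith

/-- The posterior variance of a gap between two arms is `O(1 / n)`. -/
lemma IsGOptimal.gap_variance_le {x : Fin K → EuclideanSpace ℝ (Fin d)} (hS : S₀.PosDef)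
    {σ : ℝ} (hσ : 0 < σ) {n : ℕ} {ω : Fin K → ℝ} (h : IsGOptimal x S₀ σ n ω)
    (hn : (∀ i, (pulls ω n i : ℝ) = ω i * n) ∨ 2 * K * d ≤ n) (i j : Fin K) :
    n * sqNorm (postCov x S₀ σ (pulls ω n)) (x i - x j) ≤ 8 * (d * σ ^ 2) := by
  set M := designPrecision x S₀ σ n ω with hM
  have hMpos : M⁻¹.PosSemidef := (posDef_designPrecision hS x σ n h.1).inv.posSemidef
  have h1 : sqNorm (postCov x S₀ σ (pulls ω n)) (x i - x j) ≤ 2 * sqNorm M⁻¹ (x i - x j) := by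
    rcases hn with hn | hn
    · rw [postCov_pulls_of_integral x σ hn]
      linarith [sqNorm_nonneg hMpos (x i - x j)]
    · exact h.sqNorm_postCov_le hS hσ hn _
  calc n * sqNorm (postCov x S₀ σ (pulls ω n)) (x i - x j)
      ≤ n * (2 * (2 * (sqNorm M⁻¹ (x i) + sqNorm M⁻¹ (x j)))) := by
        gcongr
        exact h1.trans (mul_le_mul_of_nonneg_left (sqNorm_sub_le hMpos _ _) (by norm_num))
    _ = 4 * (n * sqNorm M⁻¹ (x i) + n * sqNorm M⁻¹ (x j)) := by ring
    _ ≤ 8 * (d * σ ^ 2) := by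
        linarith [h.sqNorm_le hS hσ i, h.sqNorm_le hS hσ j]

/-! ### One-dimensional Gaussian estimates -/

section

/-- Gaussian tail bound, `s` being the variance. -/
lemma gaussianReal_real_Iic_neg_le (s : NNReal) (hs : s ≠ 0) {a : ℝ} (ha : 0 ≤ a) :
    (gaussianReal 0 s).real {z | z ≤ -a} ≤ Real.exp (-(a ^ 2 / (2 * s))) := by
  have hs' : (s : ℝ) ≠ 0 := by exact_mod_cast hs
  -- `t = -a / s` minimises the Chernoff bound
  have h := measure_le_le_exp_mul_mgf (μ := gaussianReal 0 s) (X := fun z => z) (-a)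
    (t := -(a / s)) (neg_nonpos.2 (by positivity)) (integrable_exp_mul_gaussianReal _)
  rw [mgf_fun_id_gaussianReal, ← Real.exp_add] at h
  refine h.trans (le_of_eq ?_)
  congr 1
  field_simp
  ring

lemma integral_exp_neg_sq_gaussianReal (δ : ℝ) (c : NNReal) {s : ℝ} (hs : 0 < s) :
    ∫ z, Real.exp (-(z ^ 2 / (2 * s))) ∂(gaussianReal δ c) =
      1 / Real.sqrt (1 + c / s) * Real.exp (-(δ ^ 2 / (2 * (s + c)))) := by
  rcases eq_or_ne c 0 with rfl | hc
  · simp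
  have hc' : (0 : ℝ) < c := by exact_mod_cast pos_iff_ne_zero.2 hc
  rw [integral_gaussianReal_eq_integral_smul hc]
  set b : ℝ := (s + c) / (2 * c * s) with hb
  have hpt : ∀ z : ℝ, gaussianPDFReal δ c z • Real.exp (-(z ^ 2 / (2 * s))) =
      ((Real.sqrt (2 * Real.pi * c))⁻¹ * Real.exp (-(δ ^ 2 / (2 * (s + c))))) *
        Real.exp (-b * (z - s * δ / (s + c)) ^ 2) := by
    intro z
    rw [gaussianPDFReal, smul_eq_mul, mul_assoc, mul_assoc (√_)⁻¹, ← Real.exp_add, ← Real.exp_add]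
    congr 2
    rw [hb]
    field_simp
    ring
  simp_rw [hpt]
  rw [integral_const_mul, integral_sub_right_eq_self (fun z => Real.exp (-b * z ^ 2)),
    integral_gaussian, mul_right_comm]
  congr 1
  rw [← Real.sqrt_inv, ← Real.sqrt_mul (by positivity), one_div, ← Real.sqrt_inv]
  congr 1
  rw [hb]
  field_simp

variable {Ω 𝓨 : Type*} {mΩ : MeasurableSpace Ω} [MeasurableSpace 𝓨] {P : Measure Ω}
  [IsProbabilityMeasure P]

/-- Conditional expectation of the sum of a function of `Y` and a centred variable independent
of `Y`. -/
lemma condExp_add_of_indepFun {Z W : Ω → ℝ} {Y : Ω → 𝓨} {f : 𝓨 → ℝ} (hW : Measurable W)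
    (hY : Measurable Y) (hf : Measurable f) (hWY : IndepFun W Y P) (hWi : Integrable W P)
    (hfi : Integrable (fun p => f (Y p)) P) (hW0 : ∫ p, W p ∂P = 0)
    (hZ : ∀ p, Z p = W p + f (Y p)) :
    P[Z | MeasurableSpace.comap Y inferInstance] =ᵐ[P] fun p => f (Y p) := by
  have hZ' : Z = W + fun p => f (Y p) := funext hZ
  have h1 := condExp_add hWi hfi (MeasurableSpace.comap Y inferInstance)
  have h2 : P[W | MeasurableSpace.comap Y inferInstance] =ᵐ[P] fun _ => P[W] :=
    condExp_indep_eq hW.comap_le hY.comap_le (comap_measurable W).stronglyMeasurable hWY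
  have h3 : P[fun p => f (Y p) | MeasurableSpace.comap Y inferInstance] = fun p => f (Y p) :=
    condExp_of_stronglyMeasurable hY.comap_le
      (hf.comp (comap_measurable Y)).stronglyMeasurable hfi
  rw [hZ']
  filter_upwards [h1, h2] with p hp1 hp2
  rw [hp1, Pi.add_apply, hp2, h3, hW0, zero_add]

/-- Bound on the probability that a centred Gaussian error `W`, independent of `Y`, reverses the
sign of an estimate `f Y` that is nonnegative on the event `Y ∈ B`. -/
lemma measureReal_sign_error_le {W : Ω → ℝ} {Y : Ω → 𝓨} {f : 𝓨 → ℝ} {B : Set 𝓨}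
    (hW : Measurable W) (hY : Measurable Y) (hf : Measurable f) (hB : MeasurableSet B)
    (hWY : IndepFun W Y P) {s : NNReal} (hs : s ≠ 0) (hlaw : P.map W = gaussianReal 0 s)
    (hpos : ∀ᵐ p ∂P, Y p ∈ B → 0 ≤ f (Y p)) :
    P.real {p | Y p ∈ B ∧ W p + f (Y p) ≤ 0} ≤
      ∫ p in Y ⁻¹' B, Real.exp (-(f (Y p) ^ 2 / (2 * s))) ∂P := by
  have : IsProbabilityMeasure (P.map Y) := Measure.isProbabilityMeasure_map hY.aemeasurable
  have hprod : P.map (fun p => (Y p, W p)) = (P.map Y).prod (gaussianReal 0 s) := by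
    rw [← hlaw]
    exact (indepFun_iff_map_prod_eq_prod_map_map hY.aemeasurable hW.aemeasurable).1 hWY.symm
  have hset : MeasurableSet {q : 𝓨 × ℝ | q.1 ∈ B ∧ q.2 + f q.1 ≤ 0} :=
    (measurable_fst hB).inter
      (measurableSet_le (measurable_snd.add (hf.comp measurable_fst)) measurable_const)
  have h1 : P.real {p | Y p ∈ B ∧ W p + f (Y p) ≤ 0} =
      ∫ y, (gaussianReal 0 s).real {z | y ∈ B ∧ z + f y ≤ 0} ∂(P.map Y) := by
    have e : {p | Y p ∈ B ∧ W p + f (Y p) ≤ 0} =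
        (fun p => (Y p, W p)) ⁻¹' {q : 𝓨 × ℝ | q.1 ∈ B ∧ q.2 + f q.1 ≤ 0} := rfl
    rw [e, ← map_measureReal_apply (hY.prodMk hW) hset, hprod, measureReal_def,
      Measure.prod_apply hset, ← integral_toReal
        (measurable_measure_prodMk_left hset).aemeasurable
        (Filter.Eventually.of_forall fun _ => measure_lt_top _ _)]
    rfl
  have hexp : Measurable fun y => Real.exp (-(f y ^ 2 / (2 * s))) := by fun_prop
  have hpos' : ∀ᵐ y ∂(P.map Y), y ∈ B → 0 ≤ f y := by
    rw [ae_map_iff hY.aemeasurable]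
    · exact hpos
    · simp only [imp_iff_not_or, Set.ofPred_or]
      exact hB.compl.union (measurableSet_le measurable_const hf)
  rw [← setIntegral_map hB hexp.aestronglyMeasurable hY.aemeasurable,
    ← integral_indicator hB, h1]
  refine integral_mono_of_nonneg (Filter.Eventually.of_forall fun _ => measureReal_nonneg) ?_ ?_
  · refine Integrable.indicator ?_ hB
    refine Integrable.of_bound hexp.aestronglyMeasurable 1 (Filter.Eventually.of_forall fun y => ?_)
    rw [Real.norm_eq_abs, Real.abs_exp, Real.exp_le_one_iff, neg_nonpos]
    positivity
  · filter_upwards [hpos'] with y hy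
    by_cases hyB : y ∈ B
    · rw [Set.indicator_of_mem hyB]
      refine le_trans (le_of_eq ?_) (gaussianReal_real_Iic_neg_le s hs (hy hyB))
      congr 1
      ext z
      simp only [hyB, true_and, Set.mem_ofPred_eq]
      constructor <;> intro h <;> linarith
    · simp [hyB]

end

/-! ### The joint law of the parameter and the rewards -/

lemma meanReward_eq_inner (x : Fin K → EuclideanSpace ℝ (Fin d)) (θ : EuclideanSpace ℝ (Fin d))
    (i : Fin K) : meanReward x θ i = inner ℝ (x i) θ := by
  simp [meanReward, EuclideanSpace.inner_eq_star_dotProduct]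

/-- The map `(θ, η) ↦ (θ, Y)` with `Y_t = η_t + θᵀ x_{A t}`, which turns prior times noise into the
joint law. -/
noncomputable def rewardMap (x : Fin K → EuclideanSpace ℝ (Fin d)) (A : Fin m → Fin K) :
    EuclideanSpace ℝ (Fin d) × (Fin m → ℝ) →L[ℝ] EuclideanSpace ℝ (Fin d) × (Fin m → ℝ) :=
  (ContinuousLinearMap.fst ℝ _ _).prod (ContinuousLinearMap.snd ℝ _ _ +
    ContinuousLinearMap.pi fun t => (innerSL ℝ (x (A t))) ∘L ContinuousLinearMap.fst ℝ _ _)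

@[simp] lemma rewardMap_fst (x : Fin K → EuclideanSpace ℝ (Fin d)) (A : Fin m → Fin K)
    (q : EuclideanSpace ℝ (Fin d) × (Fin m → ℝ)) : (rewardMap x A q).1 = q.1 := rfl

@[simp] lemma rewardMap_snd (x : Fin K → EuclideanSpace ℝ (Fin d)) (A : Fin m → Fin K)
    (q : EuclideanSpace ℝ (Fin d) × (Fin m → ℝ)) (t : Fin m) :
    (rewardMap x A q).2 t = q.2 t + inner ℝ (x (A t)) q.1 := rfl

/-- Law of the reward noise. -/
noncomputable def noiseLaw (σ : ℝ) (m : ℕ) : Measure (Fin m → ℝ) :=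
  Measure.pi fun _ => gaussianReal 0 (σ ^ 2).toNNReal

instance (σ : ℝ) (m : ℕ) : IsProbabilityMeasure (noiseLaw σ m) := by
  unfold noiseLaw; infer_instance

instance (σ : ℝ) (m : ℕ) : IsGaussian (noiseLaw σ m) := by
  have h1 : ∀ t : Fin m, HasGaussianLaw (fun η : Fin m → ℝ => η t) (noiseLaw σ m) := fun t => by
    refine ⟨?_⟩
    have : (noiseLaw σ m).map (fun η => η t) = gaussianReal 0 (σ ^ 2).toNNReal :=
      (measurePreserving_eval (fun _ : Fin m => gaussianReal 0 (σ ^ 2).toNNReal) t).map_eq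
    rw [this]
    infer_instance
  have h2 : iIndepFun (fun (t : Fin m) (η : Fin m → ℝ) => η t) (noiseLaw σ m) :=
    iIndepFun_pi (X := fun _ z => z) (fun _ => aemeasurable_id)
  have h3 := (h2.hasGaussianLaw h1).isGaussian_map
  rwa [show (fun ω : Fin m → ℝ => fun t => ω t) = id from rfl, Measure.map_id] at h3

lemma jointLaw_eq_map (x : Fin K → EuclideanSpace ℝ (Fin d)) (μ₀ : EuclideanSpace ℝ (Fin d))
    (σ : ℝ) (A : Fin m → Fin K) :
    jointLaw x μ₀ S₀ σ A =
      ((multivariateGaussian μ₀ S₀).prod (noiseLaw σ m)).map (rewardMap x A) := by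
  ext s hs
  have hL : Measurable (rewardMap x A) := (rewardMap x A).continuous.measurable
  rw [jointLaw, Measure.compProd_apply hs, Measure.map_apply hL hs, Measure.prod_apply (hL hs)]
  refine lintegral_congr fun θ => ?_
  have h : rewardKernel x σ A θ =
      Measure.pi fun t => gaussianReal (meanReward x θ (A t)) (σ ^ 2).toNNReal := rfl
  rw [h, pi_gaussianReal_eq_map, Measure.map_apply (by fun_prop) (measurable_prodMk_left hs)]
  change noiseLaw σ m _ = _
  congr 1

instance (x : Fin K → EuclideanSpace ℝ (Fin d)) (μ₀ : EuclideanSpace ℝ (Fin d))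
    (σ : ℝ) (A : Fin m → Fin K) : IsGaussian (jointLaw x μ₀ S₀ σ A) := by
  rw [jointLaw_eq_map]
  infer_instance

section Moments

variable (x : Fin K → EuclideanSpace ℝ (Fin d)) (μ₀ : EuclideanSpace ℝ (Fin d)) (σ : ℝ)
  (A : Fin m → Fin K)

lemma memLp_inner_fst (v : EuclideanSpace ℝ (Fin d)) :
    MemLp (fun p : EuclideanSpace ℝ (Fin d) × (Fin m → ℝ) => inner ℝ v p.1) 2
      (jointLaw x μ₀ S₀ σ A) :=
  IsGaussian.memLp_dual (jointLaw x μ₀ S₀ σ A) ((innerSL ℝ v) ∘L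
    ContinuousLinearMap.fst ℝ (EuclideanSpace ℝ (Fin d)) (Fin m → ℝ)) 2 (by simp)

lemma memLp_snd_apply (t : Fin m) :
    MemLp (fun p : EuclideanSpace ℝ (Fin d) × (Fin m → ℝ) => p.2 t) 2 (jointLaw x μ₀ S₀ σ A) :=
  IsGaussian.memLp_dual (jointLaw x μ₀ S₀ σ A)
    ((ContinuousLinearMap.proj (R := ℝ) (φ := fun _ : Fin m => ℝ) t) ∘L
      ContinuousLinearMap.snd ℝ (EuclideanSpace ℝ (Fin d)) (Fin m → ℝ)) 2 (by simp)

lemma memLp_prior (v : EuclideanSpace ℝ (Fin d)) :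
    MemLp (fun θ => inner ℝ v θ) 2 (multivariateGaussian μ₀ S₀) :=
  IsGaussian.memLp_dual _ (innerSL ℝ v) 2 (by simp)

lemma memLp_noise (t : Fin m) : MemLp (fun η : Fin m → ℝ => η t) 2 (noiseLaw σ m) :=
  IsGaussian.memLp_dual (noiseLaw σ m)
    (ContinuousLinearMap.proj (R := ℝ) (φ := fun _ : Fin m => ℝ) t) 2 (by simp)

lemma covariance_prior (hS : S₀.PosDef) (v w : EuclideanSpace ℝ (Fin d)) :
    cov[fun θ => inner ℝ v θ, fun θ => inner ℝ w θ; multivariateGaussian μ₀ S₀] =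
      v.ofLp ⬝ᵥ S₀ *ᵥ w.ofLp := by
  rw [← covarianceBilin_multivariateGaussian hS.posSemidef,
    covarianceBilin_apply_eq_cov (IsGaussian.memLp_id _ 2 (by simp))]

lemma covariance_noise (s t : Fin m) :
    cov[fun η : Fin m → ℝ => η s, fun η => η t; noiseLaw σ m] = if s = t then σ ^ 2 else 0 := by
  have h2 : iIndepFun (fun (t : Fin m) (η : Fin m → ℝ) => η t) (noiseLaw σ m) :=
    iIndepFun_pi (X := fun _ z => z) (fun _ => aemeasurable_id)
  split_ifs with h
  · subst h
    rw [covariance_self (measurable_pi_apply s).aemeasurable]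
    have h3 := (measurePreserving_eval
      (fun _ : Fin m => gaussianReal 0 (σ ^ 2).toNNReal) s).variance_fun_comp
      (f := fun z => z) (by fun_prop)
    rw [variance_fun_id_gaussianReal] at h3
    simpa [noiseLaw, Real.coe_toNNReal _ (sq_nonneg σ)] using h3
  · exact (h2.indepFun h).covariance_eq_zero (memLp_noise σ s) (memLp_noise σ t)

lemma covariance_prod_snd_snd (s t : Fin m) :
    cov[fun q => q.2 s, fun q => q.2 t; (multivariateGaussian μ₀ S₀).prod (noiseLaw σ m)] =
      if s = t then σ ^ 2 else 0 := by
  rw [← covariance_noise σ]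
  have h : noiseLaw σ m = ((multivariateGaussian μ₀ S₀).prod (noiseLaw σ m)).map Prod.snd :=
    measurePreserving_snd.map_eq.symm
  conv_rhs => rw [h, covariance_map_fun (measurable_pi_apply s).aestronglyMeasurable
    (measurable_pi_apply t).aestronglyMeasurable (by fun_prop)]

lemma covariance_prod_fst_fst (hS : S₀.PosDef) (v w : EuclideanSpace ℝ (Fin d)) :
    cov[fun q => inner ℝ v q.1, fun q => inner ℝ w q.1;
      (multivariateGaussian μ₀ S₀).prod (noiseLaw σ m)] = v.ofLp ⬝ᵥ S₀ *ᵥ w.ofLp := by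
  rw [← covariance_prior μ₀ hS]
  have h : multivariateGaussian μ₀ S₀ =
      ((multivariateGaussian μ₀ S₀).prod (noiseLaw σ m)).map Prod.fst :=
    measurePreserving_fst.map_eq.symm
  conv_rhs => rw [h, covariance_map_fun (by fun_prop) (by fun_prop) (by fun_prop)]

lemma covariance_fst_fst (hS : S₀.PosDef) (v w : EuclideanSpace ℝ (Fin d)) :
    cov[fun p => inner ℝ v p.1, fun p => inner ℝ w p.1; jointLaw x μ₀ S₀ σ A] =
      v.ofLp ⬝ᵥ S₀ *ᵥ w.ofLp := by
  rw [jointLaw_eq_map, covariance_map_fun (by fun_prop) (by fun_prop) (by fun_prop)]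
  exact covariance_prod_fst_fst μ₀ σ hS v w

lemma covariance_fst_snd (hS : S₀.PosDef) (v : EuclideanSpace ℝ (Fin d)) (t : Fin m) :
    cov[fun p => inner ℝ v p.1, fun p => p.2 t; jointLaw x μ₀ S₀ σ A] =
      v.ofLp ⬝ᵥ S₀ *ᵥ (x (A t)).ofLp := by
  rw [jointLaw_eq_map, covariance_map_fun (by fun_prop) (by fun_prop) (by fun_prop)]
  simp only [rewardMap_fst, rewardMap_snd]
  have h1 := (memLp_prior (S₀ := S₀) μ₀ v).comp_fst (noiseLaw σ m)
  have h2 := (memLp_prior (S₀ := S₀) μ₀ (x (A t))).comp_fst (noiseLaw σ m)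
  have h3 := (memLp_noise σ t).comp_snd (multivariateGaussian μ₀ S₀)
  have h4 := covariance_fst_snd_prod (memLp_prior (S₀ := S₀) μ₀ v) (memLp_noise σ t)
  have h5 := covariance_add_right h1 h3 h2
  refine h5.trans ?_
  rw [h4, covariance_prod_fst_fst μ₀ σ hS, zero_add]

lemma covariance_snd_snd (hS : S₀.PosDef) (s t : Fin m) :
    cov[fun p => p.2 s, fun p => p.2 t; jointLaw x μ₀ S₀ σ A] =
      (x (A s)).ofLp ⬝ᵥ S₀ *ᵥ (x (A t)).ofLp + if s = t then σ ^ 2 else 0 := by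
  rw [jointLaw_eq_map, covariance_map_fun (by fun_prop) (by fun_prop) (by fun_prop)]
  simp only [rewardMap_snd]
  have h1 := fun t : Fin m => (memLp_prior (S₀ := S₀) μ₀ (x (A t))).comp_fst (noiseLaw σ m)
  have h3 := fun t : Fin m => (memLp_noise σ t).comp_snd (multivariateGaussian μ₀ S₀)
  have h4 := fun s t : Fin m =>
    covariance_fst_snd_prod (memLp_prior (S₀ := S₀) μ₀ (x (A s))) (memLp_noise (m := m) σ t)
  refine (covariance_add_left (h3 s) (h1 s) ((h3 t).add (h1 t))).trans ?_
  rw [covariance_add_right (h3 s) (h3 t) (h1 t), covariance_add_right (h1 s) (h3 t) (h1 t),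
    covariance_prod_fst_fst μ₀ σ hS, h4, covariance_prod_snd_snd,
    covariance_comm, h4]
  ring

lemma integral_inner_prior (v : EuclideanSpace ℝ (Fin d)) :
    ∫ θ, inner ℝ v θ ∂(multivariateGaussian μ₀ S₀) = inner ℝ v μ₀ := by
  have h := (innerSL ℝ v).integral_comp_comm
    (IsGaussian.integrable_id (μ := multivariateGaussian μ₀ S₀))
  simpa using h

lemma integral_inner_fst (v : EuclideanSpace ℝ (Fin d)) :
    ∫ p, inner ℝ v p.1 ∂(jointLaw x μ₀ S₀ σ A) = inner ℝ v μ₀ := by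
  rw [jointLaw_eq_map, integral_map (by fun_prop) (by fun_prop), ← integral_inner_prior (S₀ := S₀)]
  simp only [rewardMap_fst]
  rw [integral_fun_fst (μ := multivariateGaussian μ₀ S₀) (ν := noiseLaw σ m)
    (fun θ => inner ℝ v θ)]
  simp

lemma integral_snd (t : Fin m) :
    ∫ p, p.2 t ∂(jointLaw x μ₀ S₀ σ A) = inner ℝ (x (A t)) μ₀ := by
  rw [jointLaw_eq_map, integral_map (by fun_prop) (by fun_prop)]
  simp only [rewardMap_snd]
  have h1 := (memLp_prior (S₀ := S₀) μ₀ (x (A t))).comp_fst (noiseLaw σ m)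
  have h3 := (memLp_noise σ t).comp_snd (multivariateGaussian μ₀ S₀)
  have h0 : ∫ η : Fin m → ℝ, η t ∂(noiseLaw σ m) = 0 := by
    have := integral_comp_eval (μ := fun _ : Fin m => gaussianReal 0 (σ ^ 2).toNNReal) (i := t)
      (f := fun z => z) (by fun_prop)
    simpa [noiseLaw] using this
  rw [integral_add (h3.integrable one_le_two) (h1.integrable one_le_two),
    integral_fun_snd (μ := multivariateGaussian μ₀ S₀) (ν := noiseLaw σ m) (fun η => η t),
    integral_fun_fst (μ := multivariateGaussian μ₀ S₀) (ν := noiseLaw σ m)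
    (fun θ => inner ℝ (x (A t)) θ), integral_inner_prior, h0]
  simp

end Moments

/-! ### The posterior mean and its error -/

section

/-- Coefficient of the reward `Y_t` in the posterior mean of `θᵀ v`, when arm `i` is played
`N i` times. -/
noncomputable def postCoeff (x : Fin K → EuclideanSpace ℝ (Fin d)) (S₀ : Matrix (Fin d) (Fin d) ℝ)
    (σ : ℝ) (N : Fin K → ℕ) (A : Fin m → Fin K) (v : EuclideanSpace ℝ (Fin d)) (t : Fin m) : ℝ :=
  (σ ^ 2)⁻¹ * (v.ofLp ⬝ᵥ postCov x S₀ σ N *ᵥ (x (A t)).ofLp)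

/-- Posterior mean `vᵀ Σ̂ (Σ₀⁻¹ μ₀ + σ⁻² ∑ t, Y_t x_{A t})` of `θᵀ v` as a function of the
rewards `y`. -/
noncomputable def postMean (x : Fin K → EuclideanSpace ℝ (Fin d)) (μ₀ : EuclideanSpace ℝ (Fin d))
    (S₀ : Matrix (Fin d) (Fin d) ℝ) (σ : ℝ) (N : Fin K → ℕ) (A : Fin m → Fin K)
    (v : EuclideanSpace ℝ (Fin d)) (y : Fin m → ℝ) : ℝ :=
  v.ofLp ⬝ᵥ postCov x S₀ σ N *ᵥ (S₀⁻¹ *ᵥ μ₀.ofLp) + ∑ t, postCoeff x S₀ σ N A v t * y t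

/-- The linear part `θᵀ v - ∑ t, postCoeff t * Y_t` of the error of the posterior mean of `θᵀ v`.
It differs from the error `postError` by a constant, and is a continuous linear map so that it is
Gaussian under the joint law. -/
noncomputable def residual (x : Fin K → EuclideanSpace ℝ (Fin d)) (S₀ : Matrix (Fin d) (Fin d) ℝ)
    (σ : ℝ) (N : Fin K → ℕ) (A : Fin m → Fin K) (v : EuclideanSpace ℝ (Fin d)) :
    EuclideanSpace ℝ (Fin d) × (Fin m → ℝ) →L[ℝ] ℝ :=
  (innerSL ℝ v) ∘L ContinuousLinearMap.fst ℝ _ _ -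
    ∑ t, postCoeff x S₀ σ N A v t • ((ContinuousLinearMap.proj (R := ℝ) (φ := fun _ : Fin m => ℝ) t)
      ∘L ContinuousLinearMap.snd ℝ _ _)

variable (x : Fin K → EuclideanSpace ℝ (Fin d)) (μ₀ : EuclideanSpace ℝ (Fin d)) (σ : ℝ)
  {N : Fin K → ℕ} {A : Fin m → Fin K}

lemma residual_apply (v : EuclideanSpace ℝ (Fin d)) (p : EuclideanSpace ℝ (Fin d) × (Fin m → ℝ)) :
    residual x S₀ σ N A v p = inner ℝ v p.1 - ∑ t, postCoeff x S₀ σ N A v t * p.2 t := by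
  simp [residual]

lemma measurable_postMean (v : EuclideanSpace ℝ (Fin d)) :
    Measurable (postMean x μ₀ S₀ σ N A v) := by
  unfold postMean
  fun_prop

lemma postMean_sub (v w : EuclideanSpace ℝ (Fin d)) (y : Fin m → ℝ) :
    postMean x μ₀ S₀ σ N A (v - w) y =
      postMean x μ₀ S₀ σ N A v y - postMean x μ₀ S₀ σ N A w y := by
  simp only [postMean, postCoeff, WithLp.ofLp_sub, sub_dotProduct, mul_sub, sub_mul,
    Finset.sum_sub_distrib]
  ring

lemma postMean_neg (v : EuclideanSpace ℝ (Fin d)) (y : Fin m → ℝ) :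
    postMean x μ₀ S₀ σ N A (-v) y = -postMean x μ₀ S₀ σ N A v y := by
  simp only [postMean, postCoeff, WithLp.ofLp_neg, neg_dotProduct, mul_neg, neg_mul,
    Finset.sum_neg_distrib]
  ring

/-- A sum over rounds, grouped by the arm played. -/
lemma sum_schedule (hA : ∀ i, (Finset.univ.filter fun t => A t = i).card = N i)
    (f : Fin K → ℝ) : ∑ t, f (A t) = ∑ i, N i * f i := by
  rw [← Finset.sum_fiberwise Finset.univ A]
  refine Finset.sum_congr rfl fun i _ => ?_
  rw [Finset.sum_congr rfl (g := fun _ => f i) fun t ht => by rw [(Finset.mem_filter.1 ht).2],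
    Finset.sum_const, hA, nsmul_eq_mul]

lemma sum_postCoeff_mul (hA : ∀ i, (Finset.univ.filter fun t => A t = i).card = N i)
    (v : EuclideanSpace ℝ (Fin d)) (w : Fin d → ℝ) :
    ∑ t, postCoeff x S₀ σ N A v t * ((x (A t)).ofLp ⬝ᵥ w) =
      v.ofLp ⬝ᵥ (postCov x S₀ σ N * ((σ ^ 2)⁻¹ • gram x (fun i => (N i : ℝ)))) *ᵥ w := by
  unfold postCoeff
  rw [sum_schedule hA fun i => (σ ^ 2)⁻¹ * (v.ofLp ⬝ᵥ postCov x S₀ σ N *ᵥ (x i).ofLp) *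
    ((x i).ofLp ⬝ᵥ w), ← Matrix.mulVec_mulVec, Matrix.smul_mulVec, gram_mulVec,
    Matrix.mulVec_smul, Matrix.mulVec_sum, dotProduct_smul, dotProduct_sum, smul_eq_mul,
    Finset.mul_sum]
  refine Finset.sum_congr rfl fun i _ => ?_
  rw [Matrix.mulVec_smul, dotProduct_smul, smul_eq_mul]
  ring

variable {σ}

lemma sum_postCoeff_mul_prior (hS : S₀.PosDef)
    (hA : ∀ i, (Finset.univ.filter fun t => A t = i).card = N i)
    (v : EuclideanSpace ℝ (Fin d)) (w : Fin d → ℝ) :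
    ∑ t, postCoeff x S₀ σ N A v t * ((x (A t)).ofLp ⬝ᵥ S₀ *ᵥ w) =
      v.ofLp ⬝ᵥ S₀ *ᵥ w - v.ofLp ⬝ᵥ postCov x S₀ σ N *ᵥ w := by
  rw [sum_postCoeff_mul x σ hA, Matrix.mulVec_mulVec, postCov_mul_gram_mul hS, Matrix.sub_mulVec,
    dotProduct_sub]

lemma memLp_sum_postCoeff (v : EuclideanSpace ℝ (Fin d)) :
    MemLp (fun p : EuclideanSpace ℝ (Fin d) × (Fin m → ℝ) => ∑ t, postCoeff x S₀ σ N A v t * p.2 t)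
      2 (jointLaw x μ₀ S₀ σ A) :=
  memLp_finsetSum _ fun t _ => (memLp_snd_apply x μ₀ σ A t).const_mul _

lemma covariance_residual_snd (hS : S₀.PosDef) (hσ : 0 < σ)
    (hA : ∀ i, (Finset.univ.filter fun t => A t = i).card = N i)
    (v : EuclideanSpace ℝ (Fin d)) (t : Fin m) :
    cov[fun p => residual x S₀ σ N A v p, fun p => p.2 t; jointLaw x μ₀ S₀ σ A] = 0 := by
  simp only [residual_apply]
  rw [covariance_fun_sub_left (memLp_inner_fst x μ₀ σ A v) (memLp_sum_postCoeff x μ₀ v)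
      (memLp_snd_apply x μ₀ σ A t), covariance_fst_snd x μ₀ σ A hS,
    covariance_fun_sum_left (fun s => (memLp_snd_apply x μ₀ σ A s).const_mul _)
      (memLp_snd_apply x μ₀ σ A t)]
  simp only [covariance_const_mul_left, covariance_snd_snd x μ₀ σ A hS, mul_add,
    Finset.sum_add_distrib, mul_ite, mul_zero, Finset.sum_ite_eq', Finset.mem_univ, if_true]
  rw [sum_postCoeff_mul_prior x hS hA, postCoeff]
  field_simp
  ring

/-- The posterior error is independent of the history: both are jointly Gaussian and
uncorrelated. -/
lemma indepFun_residual (hS : S₀.PosDef) (hσ : 0 < σ)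
    (hA : ∀ i, (Finset.univ.filter fun t => A t = i).card = N i) (v : EuclideanSpace ℝ (Fin d)) :
    IndepFun (residual x S₀ σ N A v) Prod.snd (jointLaw x μ₀ S₀ σ A) := by
  have hG : HasGaussianLaw (fun p : EuclideanSpace ℝ (Fin d) × (Fin m → ℝ) =>
      ((fun _ : Unit => residual x S₀ σ N A v p), fun t => p.2 t)) (jointLaw x μ₀ S₀ σ A) :=
    (IsGaussian.hasGaussianLaw_id (μ := jointLaw x μ₀ S₀ σ A)).map
      ((ContinuousLinearMap.pi fun _ : Unit => residual x S₀ σ N A v).prod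
        (ContinuousLinearMap.snd ℝ _ _))
  have h := hG.indepFun_of_covariance_eval fun _ t => covariance_residual_snd x μ₀ hS hσ hA v t
  exact h.comp (measurable_pi_apply ()) measurable_id

lemma memLp_residual (v : EuclideanSpace ℝ (Fin d)) :
    MemLp (residual x S₀ σ N A v) 2 (jointLaw x μ₀ S₀ σ A) :=
  IsGaussian.memLp_dual _ _ 2 (by simp)

lemma variance_residual (hS : S₀.PosDef) (hσ : 0 < σ)
    (hA : ∀ i, (Finset.univ.filter fun t => A t = i).card = N i) (v : EuclideanSpace ℝ (Fin d)) :
    Var[residual x S₀ σ N A v; jointLaw x μ₀ S₀ σ A] = sqNorm (postCov x S₀ σ N) v := by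
  have h0 := covariance_residual_snd x μ₀ hS hσ hA v
  rw [← covariance_self (memLp_residual x μ₀ v).aemeasurable]
  have h1 : cov[fun p => residual x S₀ σ N A v p, fun p => residual x S₀ σ N A v p;
      jointLaw x μ₀ S₀ σ A] = cov[fun p => residual x S₀ σ N A v p, fun p => inner ℝ v p.1;
      jointLaw x μ₀ S₀ σ A] := by
    conv_lhs => enter [2, p]; rw [residual_apply]
    rw [covariance_fun_sub_right (memLp_residual x μ₀ v) (memLp_inner_fst x μ₀ σ A v)
      (memLp_sum_postCoeff x μ₀ v), covariance_fun_sum_right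
      (fun s => (memLp_snd_apply x μ₀ σ A s).const_mul _) (memLp_residual x μ₀ v)]
    simp only [covariance_const_mul_right, h0, mul_zero, Finset.sum_const_zero, sub_zero]
  refine h1.trans ?_
  simp only [residual_apply]
  rw [covariance_fun_sub_left (memLp_inner_fst x μ₀ σ A v) (memLp_sum_postCoeff x μ₀ v)
      (memLp_inner_fst x μ₀ σ A v), covariance_fst_fst x μ₀ σ A hS,
    covariance_fun_sum_left (fun s => (memLp_snd_apply x μ₀ σ A s).const_mul _)
      (memLp_inner_fst x μ₀ σ A v)]
  have h2 : ∀ t, cov[fun p => p.2 t, fun p => inner ℝ v p.1; jointLaw x μ₀ S₀ σ A] =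
      (x (A t)).ofLp ⬝ᵥ S₀ *ᵥ v.ofLp := fun t => by
    rw [covariance_comm, covariance_fst_snd x μ₀ σ A hS, dotProduct_mulVec_symm hS.isHermitian]
  simp only [covariance_const_mul_left, h2]
  rw [sum_postCoeff_mul_prior x hS hA, sqNorm]
  ring

lemma inner_eq_dotProduct (v w : EuclideanSpace ℝ (Fin d)) :
    (inner ℝ v w : ℝ) = v.ofLp ⬝ᵥ w.ofLp := by
  rw [EuclideanSpace.inner_eq_star_dotProduct, dotProduct_comm, star_trivial]

lemma integral_residual (hS : S₀.PosDef)
    (hA : ∀ i, (Finset.univ.filter fun t => A t = i).card = N i) (v : EuclideanSpace ℝ (Fin d)) :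
    ∫ p, residual x S₀ σ N A v p ∂(jointLaw x μ₀ S₀ σ A) =
      v.ofLp ⬝ᵥ postCov x S₀ σ N *ᵥ (S₀⁻¹ *ᵥ μ₀.ofLp) := by
  simp only [residual_apply]
  rw [integral_sub ((memLp_inner_fst x μ₀ σ A v).integrable one_le_two)
    ((memLp_sum_postCoeff x μ₀ v).integrable one_le_two), integral_inner_fst,
    integral_finsetSum _ fun t _ =>
      ((memLp_snd_apply x μ₀ σ A t).integrable one_le_two).const_mul _]
  simp only [integral_const_mul, integral_snd, inner_eq_dotProduct]
  have hu : IsUnit S₀.det := hS.isUnit.map Matrix.detMonoidHom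
  have h : μ₀.ofLp = S₀ *ᵥ (S₀⁻¹ *ᵥ μ₀.ofLp) := by
    rw [Matrix.mulVec_mulVec, Matrix.mul_nonsing_inv _ hu, Matrix.one_mulVec]
  have h2 := sum_postCoeff_mul_prior (σ := σ) x hS hA v (S₀⁻¹ *ᵥ μ₀.ofLp)
  rw [← h] at h2
  rw [h2]
  ring

/-- Centred posterior error `θᵀ v - E[θᵀ v | Y]`. -/
noncomputable def postError (x : Fin K → EuclideanSpace ℝ (Fin d)) (μ₀ : EuclideanSpace ℝ (Fin d))
    (S₀ : Matrix (Fin d) (Fin d) ℝ) (σ : ℝ) (N : Fin K → ℕ) (A : Fin m → Fin K)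
    (v : EuclideanSpace ℝ (Fin d)) (p : EuclideanSpace ℝ (Fin d) × (Fin m → ℝ)) : ℝ :=
  residual x S₀ σ N A v p - v.ofLp ⬝ᵥ postCov x S₀ σ N *ᵥ (S₀⁻¹ *ᵥ μ₀.ofLp)

lemma postError_add_postMean (v : EuclideanSpace ℝ (Fin d))
    (p : EuclideanSpace ℝ (Fin d) × (Fin m → ℝ)) :
    inner ℝ v p.1 = postError x μ₀ S₀ σ N A v p + postMean x μ₀ S₀ σ N A v p.2 := by
  rw [postError, postMean, residual_apply]
  ring

lemma measurable_postError (v : EuclideanSpace ℝ (Fin d)) :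
    Measurable (postError x μ₀ S₀ σ N A v) := by
  unfold postError
  exact (residual x S₀ σ N A v).continuous.measurable.sub_const _

lemma indepFun_postError (hS : S₀.PosDef) (hσ : 0 < σ)
    (hA : ∀ i, (Finset.univ.filter fun t => A t = i).card = N i) (v : EuclideanSpace ℝ (Fin d)) :
    IndepFun (postError x μ₀ S₀ σ N A v) Prod.snd (jointLaw x μ₀ S₀ σ A) :=
  (indepFun_residual x μ₀ hS hσ hA v).comp
    (φ := fun z => z - v.ofLp ⬝ᵥ postCov x S₀ σ N *ᵥ (S₀⁻¹ *ᵥ μ₀.ofLp))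
    (measurable_id.sub_const _) measurable_id

lemma map_postError (hS : S₀.PosDef) (hσ : 0 < σ)
    (hA : ∀ i, (Finset.univ.filter fun t => A t = i).card = N i) (v : EuclideanSpace ℝ (Fin d)) :
    (jointLaw x μ₀ S₀ σ A).map (postError x μ₀ S₀ σ N A v) =
      gaussianReal 0 (sqNorm (postCov x S₀ σ N) v).toNNReal := by
  have h1 : HasGaussianLaw (residual x S₀ σ N A v) (jointLaw x μ₀ S₀ σ A) :=
    (IsGaussian.hasGaussianLaw_id (μ := jointLaw x μ₀ S₀ σ A)).map (residual x S₀ σ N A v)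
  have h2 : postError x μ₀ S₀ σ N A v = (fun z => z - v.ofLp ⬝ᵥ postCov x S₀ σ N *ᵥ
      (S₀⁻¹ *ᵥ μ₀.ofLp)) ∘ (residual x S₀ σ N A v) := rfl
  rw [h2, ← Measure.map_map (by fun_prop) (residual x S₀ σ N A v).continuous.measurable,
    h1.map_eq_gaussianReal, variance_residual x μ₀ hS hσ hA, integral_residual x μ₀ hS hA,
    gaussianReal_map_sub_const, sub_self]

lemma memLp_postMean (v : EuclideanSpace ℝ (Fin d)) :
    MemLp (fun p : EuclideanSpace ℝ (Fin d) × (Fin m → ℝ) => postMean x μ₀ S₀ σ N A v p.2)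
      2 (jointLaw x μ₀ S₀ σ A) :=
  (memLp_const (v.ofLp ⬝ᵥ postCov x S₀ σ N *ᵥ (S₀⁻¹ *ᵥ μ₀.ofLp))).add
    (memLp_sum_postCoeff x μ₀ v)

lemma memLp_postError (v : EuclideanSpace ℝ (Fin d)) :
    MemLp (postError x μ₀ S₀ σ N A v) 2 (jointLaw x μ₀ S₀ σ A) :=
  (memLp_residual x μ₀ v).sub (memLp_const _)

lemma integral_postError (hS : S₀.PosDef)
    (hA : ∀ i, (Finset.univ.filter fun t => A t = i).card = N i) (v : EuclideanSpace ℝ (Fin d)) :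
    ∫ p, postError x μ₀ S₀ σ N A v p ∂(jointLaw x μ₀ S₀ σ A) = 0 := by
  unfold postError
  rw [integral_sub ((memLp_residual x μ₀ v).integrable one_le_two) (integrable_const _),
    integral_residual x μ₀ hS hA]
  simp

lemma postMeanReward_ae_eq (hS : S₀.PosDef) (hσ : 0 < σ)
    (hA : ∀ i, (Finset.univ.filter fun t => A t = i).card = N i) (i : Fin K) :
    postMeanReward x μ₀ S₀ σ A i =ᵐ[jointLaw x μ₀ S₀ σ A]
      fun p => postMean x μ₀ S₀ σ N A (x i) p.2 :=
  condExp_add_of_indepFun (measurable_postError x μ₀ (x i)) measurable_snd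
    (measurable_postMean x μ₀ σ (x i)) (indepFun_postError x μ₀ hS hσ hA (x i))
    ((memLp_postError x μ₀ (x i)).integrable one_le_two)
    ((memLp_postMean x μ₀ (x i)).integrable one_le_two) (integral_postError x μ₀ hS hA (x i))
    fun p => by rw [meanReward_eq_inner, postError_add_postMean]

lemma integral_postMean (hS : S₀.PosDef)
    (hA : ∀ i, (Finset.univ.filter fun t => A t = i).card = N i) (v : EuclideanSpace ℝ (Fin d)) :
    ∫ p, postMean x μ₀ S₀ σ N A v p.2 ∂(jointLaw x μ₀ S₀ σ A) = inner ℝ v μ₀ := by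
  rw [← integral_inner_fst x (S₀ := S₀) μ₀ σ A v]
  simp only [postError_add_postMean (N := N) (A := A) (S₀ := S₀) (σ := σ) x μ₀ v]
  rw [integral_add ((memLp_postError x μ₀ v).integrable one_le_two)
    ((memLp_postMean x μ₀ v).integrable one_le_two), integral_postError x μ₀ hS hA, zero_add]

lemma variance_postMean (hS : S₀.PosDef) (hσ : 0 < σ)
    (hA : ∀ i, (Finset.univ.filter fun t => A t = i).card = N i) (v : EuclideanSpace ℝ (Fin d)) :
    Var[fun p => postMean x μ₀ S₀ σ N A v p.2; jointLaw x μ₀ S₀ σ A] =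
      sqNorm S₀ v - sqNorm (postCov x S₀ σ N) v := by
  have h1 := (indepFun_postError x μ₀ hS hσ hA v).comp measurable_id
    (measurable_postMean (N := N) (A := A) (S₀ := S₀) x μ₀ σ v)
  have h2 := h1.variance_add (memLp_postError x μ₀ v) (memLp_postMean x μ₀ v)
  have h3 : (postError x μ₀ S₀ σ N A v + fun p => postMean x μ₀ S₀ σ N A v p.2) =
      fun p => inner ℝ v p.1 := by
    ext p
    exact (postError_add_postMean x μ₀ v p).symm
  have h4 : Var[postError x μ₀ S₀ σ N A v; jointLaw x μ₀ S₀ σ A] =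
      sqNorm (postCov x S₀ σ N) v := by
    rw [← variance_residual x μ₀ hS hσ hA v]
    exact variance_sub_const (memLp_residual x μ₀ v).aestronglyMeasurable _
  rw [h3, h4, ← covariance_self (memLp_inner_fst x μ₀ σ A v).aemeasurable,
    covariance_fst_fst x μ₀ σ A hS] at h2
  rw [sqNorm, h2]
  ring

lemma map_postMean (hS : S₀.PosDef) (hσ : 0 < σ)
    (hA : ∀ i, (Finset.univ.filter fun t => A t = i).card = N i) (v : EuclideanSpace ℝ (Fin d)) :
    (jointLaw x μ₀ S₀ σ A).map (fun p => postMean x μ₀ S₀ σ N A v p.2) =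
      gaussianReal (inner ℝ v μ₀) (sqNorm S₀ v - sqNorm (postCov x S₀ σ N) v).toNNReal := by
  set L : EuclideanSpace ℝ (Fin d) × (Fin m → ℝ) →L[ℝ] ℝ :=
    (innerSL ℝ v) ∘L ContinuousLinearMap.fst ℝ _ _ - residual x S₀ σ N A v with hL
  have h1 : HasGaussianLaw L (jointLaw x μ₀ S₀ σ A) :=
    (IsGaussian.hasGaussianLaw_id (μ := jointLaw x μ₀ S₀ σ A)).map L
  have h2 : (fun p => postMean x μ₀ S₀ σ N A v p.2) = (fun z => (v.ofLp ⬝ᵥ postCov x S₀ σ N *ᵥ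
      (S₀⁻¹ *ᵥ μ₀.ofLp)) + z) ∘ L := by
    ext p
    simp [hL, postMean, residual_apply]
  have h3 : HasGaussianLaw (fun p => postMean x μ₀ S₀ σ N A v p.2) (jointLaw x μ₀ S₀ σ A) := by
    refine ⟨?_⟩
    rw [h2, ← Measure.map_map (by fun_prop) L.continuous.measurable, h1.map_eq_gaussianReal]
    infer_instance
  rw [h3.map_eq_gaussianReal, integral_postMean x μ₀ hS hA, variance_postMean x μ₀ hS hσ hA]

end

/-! ### Probability of error -/

section Error

variable (x : Fin K → EuclideanSpace ℝ (Fin d)) (μ₀ : EuclideanSpace ℝ (Fin d)) {σ : ℝ}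
  {N : Fin K → ℕ} {A : Fin m → Fin K} {J : (Fin m → ℝ) → Fin K}

/-- The event that arm `i` is returned although arm `j` is at least as good. -/
def confusion (J : (Fin m → ℝ) → Fin K) (i j : Fin K) :
    Set (EuclideanSpace ℝ (Fin d) × (Fin m → ℝ)) :=
  {p | J p.2 = i ∧ meanReward x p.1 i ≤ meanReward x p.1 j}

lemma measurableSet_confusion (hJ : Measurable J) (i j : Fin K) :
    MeasurableSet (confusion x J i j) :=
  ((hJ.comp measurable_snd) (measurableSet_singleton i)).inter
    (measurableSet_le ((measurable_meanReward x i).comp measurable_fst)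
      ((measurable_meanReward x j).comp measurable_fst))

/-- Union bound over the returned arm and the optimal arm. -/
lemma expectedPoE_le_sum (hJ : Measurable J) {iStar : EuclideanSpace ℝ (Fin d) → Fin K}
    (hi : IsOptimalArm x iStar) :
    expectedPoE x μ₀ S₀ σ A J iStar ≤
      ∑ i, ∑ j ∈ Finset.univ.erase i, (jointLaw x μ₀ S₀ σ A).real (confusion x J i j) := by
  have hmeas : ∀ i j, Measurable fun θ =>
      (rewardKernel x σ A θ).real (Prod.mk θ ⁻¹' confusion x J i j) := fun i j =>
    (Kernel.measurable_kernel_prodMk_left (measurableSet_confusion x hJ i j)).ennreal_toReal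
  have hint : ∀ i j, Integrable (fun θ =>
      (rewardKernel x σ A θ).real (Prod.mk θ ⁻¹' confusion x J i j))
      (multivariateGaussian μ₀ S₀) := fun i j =>
    Integrable.of_bound (hmeas i j).aestronglyMeasurable 1
      (Filter.Eventually.of_forall fun θ => by
        rw [Real.norm_of_nonneg measureReal_nonneg]; exact measureReal_le_one)
  have hreal : ∀ i j, (jointLaw x μ₀ S₀ σ A).real (confusion x J i j) =
      ∫ θ, (rewardKernel x σ A θ).real (Prod.mk θ ⁻¹' confusion x J i j)
        ∂(multivariateGaussian μ₀ S₀) := fun i j => by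
    rw [measureReal_def, jointLaw, Measure.compProd_apply (measurableSet_confusion x hJ i j),
      ← integral_toReal (Kernel.measurable_kernel_prodMk_left
        (measurableSet_confusion x hJ i j)).aemeasurable
        (Filter.Eventually.of_forall fun _ => measure_lt_top _ _)]
    rfl
  simp_rw [hreal]
  have hsum : (∑ i, ∑ j ∈ Finset.univ.erase i, ∫ θ, (rewardKernel x σ A θ).real
      (Prod.mk θ ⁻¹' confusion x J i j) ∂(multivariateGaussian μ₀ S₀)) =
      ∫ θ, ∑ i, ∑ j ∈ Finset.univ.erase i, (rewardKernel x σ A θ).real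
      (Prod.mk θ ⁻¹' confusion x J i j) ∂(multivariateGaussian μ₀ S₀) := by
    rw [integral_finsetSum _ fun i _ => integrable_finsetSum _ fun j _ => hint i j]
    exact Finset.sum_congr rfl fun i _ => (integral_finsetSum _ fun j _ => hint i j).symm
  rw [hsum]
  -- nothing is assumed on the measurability of `iStar`, so only the bound is shown integrable
  refine integral_mono_of_nonneg (Filter.Eventually.of_forall fun _ => measureReal_nonneg)
    (integrable_finsetSum _ fun i _ => integrable_finsetSum _ fun j _ => hint i j)
    (Filter.Eventually.of_forall fun θ => ?_)
  have hsub : {y | J y ≠ iStar θ} ⊆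
      ⋃ i, ⋃ j ∈ Finset.univ.erase i, (Prod.mk θ ⁻¹' confusion x J i j) := fun y hy => by
    simp only [Set.mem_iUnion]
    exact ⟨J y, iStar θ, Finset.mem_erase.2 ⟨fun h => hy h.symm, Finset.mem_univ _⟩, rfl, hi θ _⟩
  refine (measureReal_mono hsub (measure_ne_top _ _)).trans ((measureReal_iUnion_fintype_le _).trans
    (Finset.sum_le_sum fun i _ => measureReal_biUnion_finset_le _ _))

lemma sqNorm_neg (S : Matrix (Fin d) (Fin d) ℝ) (v : EuclideanSpace ℝ (Fin d)) :
    sqNorm S (-v) = sqNorm S v := by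
  simp [sqNorm, Matrix.mulVec_neg]

/-- Gaussian weight `exp (-Δ² / (2 s))` of the posterior mean `Δ` of `θᵀ v`, where `s` is the
posterior variance. -/
noncomputable def gapWeight (x : Fin K → EuclideanSpace ℝ (Fin d)) (μ₀ : EuclideanSpace ℝ (Fin d))
    (S₀ : Matrix (Fin d) (Fin d) ℝ) (σ : ℝ) (N : Fin K → ℕ) (A : Fin m → Fin K)
    (v : EuclideanSpace ℝ (Fin d)) (p : EuclideanSpace ℝ (Fin d) × (Fin m → ℝ)) : ℝ :=
  Real.exp (-(postMean x μ₀ S₀ σ N A v p.2 ^ 2 / (2 * sqNorm (postCov x S₀ σ N) v)))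

lemma gapWeight_neg (v : EuclideanSpace ℝ (Fin d)) :
    gapWeight x μ₀ S₀ σ N A (-v) = gapWeight x μ₀ S₀ σ N A v := by
  ext p
  rw [gapWeight, gapWeight, postMean_neg, sqNorm_neg, neg_sq]

lemma integrable_gapWeight (hS : S₀.PosDef) (v : EuclideanSpace ℝ (Fin d)) :
    Integrable (gapWeight x μ₀ S₀ σ N A v) (jointLaw x μ₀ S₀ σ A) := by
  have hm : Measurable (gapWeight x μ₀ S₀ σ N A v) := by
    have : Measurable fun p : EuclideanSpace ℝ (Fin d) × (Fin m → ℝ) =>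
        postMean x μ₀ S₀ σ N A v p.2 := (measurable_postMean x μ₀ σ v).comp measurable_snd
    exact (((this.pow_const 2).div_const _).neg).exp
  refine Integrable.of_bound hm.aestronglyMeasurable 1 (Filter.Eventually.of_forall fun p => ?_)
  have := sqNorm_nonneg (posDef_postCov hS x σ N).posSemidef v
  rw [gapWeight, Real.norm_eq_abs, Real.abs_exp, Real.exp_le_one_iff, neg_nonpos]
  positivity

lemma measureReal_confusion_le (hS : S₀.PosDef) (hσ : 0 < σ)
    (hA : ∀ i, (Finset.univ.filter fun t => A t = i).card = N i)
    (hJ : IsPIBAIDecision x μ₀ S₀ σ A J) {i j : Fin K} (hij : x i ≠ x j) :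
    (jointLaw x μ₀ S₀ σ A).real (confusion x J i j) ≤
      ∫ p in (fun p => J p.2) ⁻¹' {i}, gapWeight x μ₀ S₀ σ N A (x i - x j) p
        ∂(jointLaw x μ₀ S₀ σ A) := by
  have hs := sqNorm_pos (posDef_postCov hS x σ N) (sub_ne_zero.2 hij)
  have h := measureReal_sign_error_le (P := jointLaw x μ₀ S₀ σ A)
    (measurable_postError (N := N) (A := A) (S₀ := S₀) (σ := σ) x μ₀ (x i - x j)) measurable_snd
    (measurable_postMean (N := N) (A := A) (S₀ := S₀) x μ₀ σ (x i - x j))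
    (hJ.1 (measurableSet_singleton i)) (indepFun_postError x μ₀ hS hσ hA (x i - x j))
    (s := (sqNorm (postCov x S₀ σ N) (x i - x j)).toNNReal) (by simpa using hs)
    (map_postError x μ₀ hS hσ hA (x i - x j)) (by
      filter_upwards [hJ.2, postMeanReward_ae_eq x μ₀ hS hσ hA i,
        postMeanReward_ae_eq x μ₀ hS hσ hA j] with p hp hpi hpj hpJ
      have hpJ' : J p.2 = i := hpJ
      have := hp j
      rw [hpJ', hpi, hpj] at this
      rw [postMean_sub]
      linarith)
  rw [Real.coe_toNNReal _ hs.le] at h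
  refine le_trans (le_of_eq ?_) h
  congr 1
  ext p
  have e := postError_add_postMean (S₀ := S₀) (σ := σ) (N := N) (A := A) x μ₀ (x i - x j) p
  rw [inner_sub_left, ← meanReward_eq_inner, ← meanReward_eq_inner] at e
  change (J p.2 = i ∧ _ ≤ _) ↔ (J p.2 = i ∧ _ ≤ _)
  rw [← e, sub_nonpos]

lemma integral_gapWeight (hS : S₀.PosDef) (hσ : 0 < σ)
    (hA : ∀ i, (Finset.univ.filter fun t => A t = i).card = N i) {v : EuclideanSpace ℝ (Fin d)}
    (hv : v ≠ 0) :
    ∫ p, gapWeight x μ₀ S₀ σ N A v p ∂(jointLaw x μ₀ S₀ σ A) =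
      1 / Real.sqrt (1 + (sqNorm S₀ v - sqNorm (postCov x S₀ σ N) v) /
        sqNorm (postCov x S₀ σ N) v) *
        Real.exp (-((inner ℝ v μ₀) ^ 2 / (2 * sqNorm S₀ v))) := by
  have hs := sqNorm_pos (posDef_postCov hS x σ N) hv
  have hc : 0 ≤ sqNorm S₀ v - sqNorm (postCov x S₀ σ N) v := by
    rw [← variance_postMean x μ₀ hS hσ hA v]
    exact variance_nonneg _ _
  have h := integral_exp_neg_sq_gaussianReal (inner ℝ v μ₀)
    (sqNorm S₀ v - sqNorm (postCov x S₀ σ N) v).toNNReal hs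
  rw [← map_postMean x μ₀ hS hσ hA v,
    integral_map (memLp_postMean x μ₀ v).aemeasurable (by fun_prop), Real.coe_toNNReal _ hc,
    add_sub_cancel] at h
  exact h

/-- The two ways of confusing a pair of arms are disjoint in the history, so that together they
cost one Gaussian integral only. -/
lemma measureReal_confusion_add_le (hS : S₀.PosDef) (hσ : 0 < σ)
    (hA : ∀ i, (Finset.univ.filter fun t => A t = i).card = N i)
    (hJ : IsPIBAIDecision x μ₀ S₀ σ A J) {i j : Fin K} (hij : x i ≠ x j) :
    (jointLaw x μ₀ S₀ σ A).real (confusion x J i j) +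
      (jointLaw x μ₀ S₀ σ A).real (confusion x J j i) ≤
      ∫ p, gapWeight x μ₀ S₀ σ N A (x i - x j) p ∂(jointLaw x μ₀ S₀ σ A) := by
  have h1 := measureReal_confusion_le x μ₀ hS hσ hA hJ hij
  have h2 := measureReal_confusion_le x μ₀ hS hσ hA hJ hij.symm
  have hi := integrable_gapWeight (N := N) (A := A) (σ := σ) x μ₀ hS (x i - x j)
  rw [← neg_sub, gapWeight_neg] at h2
  have hm : ∀ k,
      MeasurableSet ((fun p : EuclideanSpace ℝ (Fin d) × (Fin m → ℝ) => J p.2) ⁻¹' {k}) :=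
    fun k => (hJ.1.comp measurable_snd) (measurableSet_singleton k)
  have hdisj : Disjoint ((fun p : EuclideanSpace ℝ (Fin d) × (Fin m → ℝ) => J p.2) ⁻¹' {i})
      ((fun p => J p.2) ⁻¹' {j}) :=
    Disjoint.preimage _ (Set.disjoint_singleton.2 fun h => hij (congrArg x h))
  refine (add_le_add h1 h2).trans ?_
  rw [← setIntegral_union hdisj (hm j) hi.integrableOn hi.integrableOn]
  exact setIntegral_le_integral hi (Filter.Eventually.of_forall fun p => (Real.exp_pos _).le)

end Error

/-- Sums over ordered pairs are compared after symmetrisation. -/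
lemma sum_erase_le_of_symm {T R : Fin K → Fin K → ℝ}
    (h : ∀ i j, i ≠ j → T i j + T j i ≤ R i j + R j i) :
    ∑ i, ∑ j ∈ Finset.univ.erase i, T i j ≤ ∑ i, ∑ j ∈ Finset.univ.erase i, R i j := by
  have hswap : ∀ f : Fin K → Fin K → ℝ, ∑ i, ∑ j ∈ Finset.univ.erase i, f j i =
      ∑ i, ∑ j ∈ Finset.univ.erase i, f i j := fun f =>
    Finset.sum_comm' (by simp [ne_comm])
  have h1 : ∑ i, ∑ j ∈ Finset.univ.erase i, (T i j + T j i) ≤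
      ∑ i, ∑ j ∈ Finset.univ.erase i, (R i j + R j i) :=
    Finset.sum_le_sum fun i _ => Finset.sum_le_sum fun j hj =>
      h i j (Finset.ne_of_mem_erase hj).symm
  simp only [Finset.sum_add_distrib] at h1
  rw [hswap T, hswap R] at h1
  linarith

/-- A posterior variance `s ≤ 4 (2 d σ² / n)` costs a factor of at most two. -/
lemma one_div_sqrt_le {n D s c : ℝ} (hn : 0 ≤ n) (hD : 0 ≤ D) (hs : 0 < s) (hc : 0 ≤ c)
    (h : n * s ≤ 4 * D) :
    1 / Real.sqrt (1 + c / s) ≤ 2 * (1 / Real.sqrt (1 + n / D * c)) := by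
  have hle : n / D ≤ 4 / s := by
    rcases hD.eq_or_lt with rfl | hD
    · simp only [div_zero]
      exact (div_pos four_pos hs).le
    · rw [div_le_div_iff₀ hD hs]
      exact h
  have h1 : Real.sqrt (1 + n / D * c) ≤ 2 * Real.sqrt (1 + c / s) := by
    rw [Real.sqrt_le_left (by positivity), mul_pow, Real.sq_sqrt (by positivity)]
    have := mul_le_mul_of_nonneg_right hle hc
    have e : 4 / s * c = 4 * (c / s) := by ring
    linarith
  rw [mul_one_div, div_le_div_iff₀ (by positivity) (by positivity)]
  linarith

lemma exists_pos_le_gap {x : Fin K → EuclideanSpace ℝ (Fin d)} (hx : Function.Injective x)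
    (hS : S₀.PosDef) : ∃ c, 0 < c ∧ ∀ i j, i ≠ j → c ≤ sqNorm S₀ (x i - x j) := by
  rcases isEmpty_or_nonempty {q : Fin K × Fin K // q.1 ≠ q.2} with h | h
  · exact ⟨1, one_pos, fun i j hij => (h.false ⟨(i, j), hij⟩).elim⟩
  · obtain ⟨q, hq⟩ := Finite.exists_min
      fun q : {q : Fin K × Fin K // q.1 ≠ q.2} => sqNorm S₀ (x q.1.1 - x q.1.2)
    exact ⟨_, sqNorm_pos hS (sub_ne_zero.2 (hx.ne q.2)), fun i j hij => hq ⟨(i, j), hij⟩⟩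

end LinearBandit

theorem corollary1 {d K : ℕ} (x : Fin K → EuclideanSpace ℝ (Fin d))
    (hx : Function.Injective x) (hspan : Submodule.span ℝ (Set.range x) = ⊤)
    (μ₀ : EuclideanSpace ℝ (Fin d)) (S₀ : Matrix (Fin d) (Fin d) ℝ)
    (hdiag : S₀.IsDiag) (hpos : S₀.PosDef) (σ : ℝ) (hσ : 0 < σ) :
    ∃ c₀ : ℝ, 0 < c₀ ∧ ∃ N : ℕ, ∀ (n : ℕ) (ω : Fin K → ℝ),
      LinearBandit.IsGOptimal x S₀ σ n ω →
      -- the constants are bounded away from zero as the budget grows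
      (N ≤ n → ∀ i j, i ≠ j →
        c₀ ≤ LinearBandit.gapConst x S₀ σ (LinearBandit.pulls ω n) i j) ∧
      ∀ (m : ℕ) (A : Fin m → Fin K), LinearBandit.IsSchedule ω n A →
        -- the constants are the variances of the differences of the mean posterior rewards
        (∀ i j, variance
            (fun p => LinearBandit.postMeanReward x μ₀ S₀ σ A i p -
              LinearBandit.postMeanReward x μ₀ S₀ σ A j p)
            (LinearBandit.jointLaw x μ₀ S₀ σ A) =
          LinearBandit.gapConst x S₀ σ (LinearBandit.pulls ω n) i j) ∧
        -- the bound holds if all `ω i * n` are integers, and in any case for large budgets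
        ∀ (J : (Fin m → ℝ) → Fin K) (iStar : EuclideanSpace ℝ (Fin d) → Fin K),
          LinearBandit.IsPIBAIDecision x μ₀ S₀ σ A J → LinearBandit.IsOptimalArm x iStar →
          ((∀ i, (LinearBandit.pulls ω n i : ℝ) = ω i * n) ∨ N ≤ n) →
          LinearBandit.expectedPoE x μ₀ S₀ σ A J iStar ≤
            ∑ i, ∑ j ∈ Finset.univ.erase i,
              1 / Real.sqrt (1 + (n : ℝ) / (2 * d * σ ^ 2) *
                  LinearBandit.gapConst x S₀ σ (LinearBandit.pulls ω n) i j) *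
                Real.exp (-((LinearBandit.meanReward x μ₀ i - LinearBandit.meanReward x μ₀ j) ^ 2 /
                  (2 * LinearBandit.sqNorm S₀ (x i - x j)))) := by

  obtain ⟨c₁, hc₁, hgap⟩ := LinearBandit.exists_pos_le_gap hx hpos
  obtain ⟨N₁, hN₁⟩ := exists_nat_gt (16 * (d * σ ^ 2) / c₁)
  refine ⟨c₁ / 2, by positivity, max N₁ (2 * K * d), fun n ω hω => ⟨fun hn i j hij => ?_,
    fun m A hA => ⟨fun i j => ?_, fun J iStar hJ hi hn => ?_⟩⟩⟩
  · have h1 := hω.gap_variance_le hpos hσ (Or.inr ((le_max_right _ _).trans hn)) i j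
    have h2 : (N₁ : ℝ) ≤ n := by exact_mod_cast (le_max_left _ _).trans hn
    have h3 : 16 * (d * σ ^ 2) < n * c₁ := by
      rw [div_lt_iff₀ hc₁] at hN₁
      exact hN₁.trans_le (mul_le_mul_of_nonneg_right h2 hc₁.le)
    have hn0 : (0 : ℝ) < n := pos_of_mul_pos_left (lt_of_le_of_lt (by positivity) h3) hc₁.le
    rw [LinearBandit.gapConst_eq hpos x hσ]
    have h4 : LinearBandit.sqNorm (LinearBandit.postCov x S₀ σ (LinearBandit.pulls ω n))
        (x i - x j) ≤ c₁ / 2 := le_of_mul_le_mul_left (by linarith) hn0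
    linarith [hgap i j hij]
  · rw [LinearBandit.gapConst_eq hpos x hσ, ← LinearBandit.variance_postMean x μ₀ hpos hσ hA]
    refine variance_congr ?_
    filter_upwards [LinearBandit.postMeanReward_ae_eq x μ₀ hpos hσ hA i,
      LinearBandit.postMeanReward_ae_eq x μ₀ hpos hσ hA j] with p h1 h2
    rw [h1, h2, LinearBandit.postMean_sub]
  · refine (LinearBandit.expectedPoE_le_sum x μ₀ hJ.1 hi).trans ?_
    have key : ∀ i j, i ≠ j →
        (LinearBandit.jointLaw x μ₀ S₀ σ A).real (LinearBandit.confusion x J i j) +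
        (LinearBandit.jointLaw x μ₀ S₀ σ A).real (LinearBandit.confusion x J j i) ≤
        2 * (1 / Real.sqrt (1 + (n : ℝ) / (2 * d * σ ^ 2) *
          LinearBandit.gapConst x S₀ σ (LinearBandit.pulls ω n) i j) *
        Real.exp (-((LinearBandit.meanReward x μ₀ i - LinearBandit.meanReward x μ₀ j) ^ 2 /
          (2 * LinearBandit.sqNorm S₀ (x i - x j))))) := by
      intro i j hij
      have h1 := hω.gap_variance_le hpos hσ (hn.symm.imp_left (le_max_right _ _).trans).symm i j
      have hs := LinearBandit.sqNorm_pos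
        (LinearBandit.posDef_postCov hpos x σ (LinearBandit.pulls ω n)) (sub_ne_zero.2 (hx.ne hij))
      have hc : 0 ≤ LinearBandit.gapConst x S₀ σ (LinearBandit.pulls ω n) i j := by
        rw [LinearBandit.gapConst_eq hpos x hσ, ← LinearBandit.variance_postMean x μ₀ hpos hσ hA]
        exact variance_nonneg _ _
      refine (LinearBandit.measureReal_confusion_add_le x μ₀ hpos hσ hA hJ (hx.ne hij)).trans ?_
      rw [LinearBandit.integral_gapWeight x μ₀ hpos hσ hA (sub_ne_zero.2 (hx.ne hij)),
        ← LinearBandit.gapConst_eq hpos x hσ, inner_sub_left, ← LinearBandit.meanReward_eq_inner,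
        ← LinearBandit.meanReward_eq_inner, ← mul_assoc 2]
      exact mul_le_mul_of_nonneg_right (LinearBandit.one_div_sqrt_le (by positivity)
        (by positivity) hs hc (by linarith)) (Real.exp_pos _).le
    refine LinearBandit.sum_erase_le_of_symm fun i j hij => ?_
    linarith [key i j hij, key j i hij.symm]
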